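/- Theorem. Let $N\ge 1$, let $\mathbb{K}$ be a field, and let $q,t\in\mathbb{K}$ be generic: $q,t\neq 0$ and $q^{a}t^{b}\neq 1$ for all $(a,b)\in\mathbb{Z}^2\setminus\{(0,0)\}$ with $-N\le b\le N$ (for instance $\mathbb{K}=\mathbb{Q}(q,t)$ with $q,t$ indeterminates, or $\mathbb{K}=\mathbb{C}$ with generic $q,t$). On $\mathcal{P}=\mathbb{K}[x_1,\dots,x_N]$ let operators act on the right, products being applied from left to right. For $1\le i<N$ put $$pT_i=(1-t)x_{i+1}\frac{p(x)-p(x.s_i)}{x_i-x_{i+1}}+t\,p(x.s_i),$$ where $s_i$ interchanges the entries $i$ and $i+1$; $T_i$ is invertible with $T_i^{-1}=\frac1t(T_i+1-t)$. Put $$fw(x)=f(qx_N,x_1,\dots,x_{N-1}),\quad f\xi_N=t^{N-1}fT_{N-1}^{-1}\cdots T_1^{-1}w,\quad f\mathcal{D}_N=\frac{f-f\xi_N}{x_N},\quad w^{*}=T_{N-1}^{-1}\cdots T_1^{-1}\,w\,T_{N-1}\cdots T_1 .$$ A symmetric bilinear form $\langle\cdot,\cdot\rangle$ on $\mathcal{P}$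 satisfies (BF1) if $\langle 1,1\rangle=1$ and, for all $f,g\in\mathcal{P}$, $$\langle fT_i,g\rangle=\langle f,gT_i\rangle\ (1\le i<N),\quad \langle f\xi_N,g\rangle=\langle f,g\xi_N\rangle,\quad \langle f\mathcal{D}_N,g\rangle=(1-q)\langle f,x_N(gw^{*}w)\rangle .$$ For $\alpha\in\mathbb{N}_0^N$ let $r_\alpha(i)=\#\{j:\alpha_j>\alpha_i\}+\#\{j\le i:\alpha_j=\alpha_i\}$ and $\zeta_\alpha(i)=q^{\alpha_i}t^{N-r_\alpha(i)}$. The nonsymmetric Macdonald polynomials $M_\alpha$ are generated along the Yang–Baxter graph: $M_{\mathbf 0}=1$; if $\alpha_i<\alpha_{i+1}$ then $$M_{\alpha.s_i}=M_\alpha T_i+\frac{1-t}{1-\zeta_\alpha(i+1)/\zeta_\alpha(i)}M_\alpha ;$$ and $M_{\alpha\Phi}=x_N(M_\alpha w)$ with $\alpha\Phi=(\alpha_2,\dots,\alpha_N,\alpha_1+1)$. Suppose $\langle\cdot,\cdot\rangle$ satisfies (BF1) and let $\lambda=(\lambda_1\ge\cdots\ge\lambda_N\ge 0)$ be a partition.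 Then $\|M_\lambda\|^2:=\langle M_\lambda,M_\lambda\rangle$ is given by $$\|M_\lambda\|^2=t^{k(\lambda)}\,\frac{h_{q,t}(\lambda;q)}{h_{q,t}(\lambda;qt)}\,\frac{(qt^{N};q,t)_\lambda}{(1-q)^{|\lambda|}},\qquad k(\lambda)=\sum_{i=1}^N(N-2i+1)\lambda_i,$$ where $h_{q,t}(\lambda;z)=\prod_{(i,j)\in\lambda}\bigl(1-zq^{\lambda_i-j}t^{\lambda'_j-i}\bigr)$ with $\lambda'$ the transpose of $\lambda$, $(z;q,t)_\lambda=\prod_{i=1}^N(zt^{1-i};q)_{\lambda_i}$ and $(z;q)_m=\prod_{i=1}^m(1-zq^{i-1})$. -/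

import Mathlib

open MvPolynomial

namespace Macdonald

/-!
Throughout `N = n + 1`; the variables `x_1, …, x_N` are `X 0, …, X (Fin.last n)`, and the index `i` of
an adjacent transposition `s_i`, `1 ≤ i < N`, is an element of `Fin n`, so that `x_i`, `x_{i+1}`
are `X i.castSucc`, `X i.succ`. Operators written on the right of their argument, composed from left
to right, become linear endomorphisms composed from right to left.
-/

/-- `q, t` are generic for `N` variables: nonzero, and `q ^ a * t ^ b ≠ 1` for all integers `a, b`,
not both zero, with `-N ≤ b ≤ N`. -/
def IsGeneric {K : Type*} [Field K] (N : ℕ) (q t : K) : Prop :=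
  q ≠ 0 ∧ t ≠ 0 ∧
    ∀ a b : ℤ, -(N : ℤ) ≤ b → b ≤ (N : ℤ) → (a, b) ≠ (0, 0) → q ^ a * t ^ b ≠ 1

/-- The adjacent transposition `s_i` of the positions `i, i + 1`. -/
def adj {n : ℕ} (i : Fin n) : Equiv.Perm (Fin (n + 1)) := Equiv.swap i.castSucc i.succ

/-! ### The Demazure–Lusztig operators -/

theorem sub_dvd_sub_rename {K : Type*} [Field K] {n : ℕ} (i : Fin n)
    (p : MvPolynomial (Fin (n + 1)) K) :
    (X i.castSucc - X i.succ : MvPolynomial (Fin (n + 1)) K) ∣ p - rename (adj i) p := by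
  induction p using MvPolynomial.induction_on with
  | C a => simp
  | add p r hp hr =>
    rw [map_add, add_sub_add_comm]
    exact dvd_add hp hr
  | mul_X p k hp =>
    have hk : (X i.castSucc - X i.succ : MvPolynomial (Fin (n + 1)) K) ∣ X k - X (adj i k) := by
      unfold adj
      by_cases h1 : k = i.castSucc
      · subst h1; simp
      · by_cases h2 : k = i.succ
        · subst h2
          rw [Equiv.swap_apply_right]
          exact (dvd_neg.mpr dvd_rfl).trans (by rw [neg_sub])
        · rw [Equiv.swap_apply_of_ne_of_ne h1 h2]; simp
    have e : p * X k - rename (adj i) (p * X k)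
        = (p - rename (adj i) p) * X k + rename (adj i) p * (X k - X (adj i k)) := by
      rw [map_mul, rename_X]; ring
    rw [e]
    exact dvd_add (hp.mul_right _) (hk.mul_left _)

theorem X_sub_X_ne_zero {K : Type*} [Field K] {n : ℕ} (i : Fin n) :
    (X i.castSucc - X i.succ : MvPolynomial (Fin (n + 1)) K) ≠ 0 := by
  intro h
  exact (Fin.castSucc_lt_succ (i := i)).ne (X_injective (sub_eq_zero.mp h))

/-- The divided difference `(p(x) - p(x.s_i)) / (x_i - x_{i+1})`, a polynomial; it is pinned down by
`mul_divDiff`. -/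
noncomputable def divDiff {K : Type*} [Field K] {n : ℕ} (i : Fin n)
    (p : MvPolynomial (Fin (n + 1)) K) : MvPolynomial (Fin (n + 1)) K :=
  Classical.choose (sub_dvd_sub_rename i p)

theorem mul_divDiff {K : Type*} [Field K] {n : ℕ} (i : Fin n)
    (p : MvPolynomial (Fin (n + 1)) K) :
    (X i.castSucc - X i.succ) * divDiff i p = p - rename (adj i) p :=
  (Classical.choose_spec (sub_dvd_sub_rename i p)).symm

/-- `p T_i = (1 - t) x_{i+1} (p(x) - p(x.s_i)) / (x_i - x_{i+1}) + t p(x.s_i)`. -/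
noncomputable def opT {K : Type*} [Field K] {n : ℕ} (t : K) (i : Fin n) :
    Module.End K (MvPolynomial (Fin (n + 1)) K) where
  toFun p := C (1 - t) * X i.succ * divDiff i p + C t * rename (adj i) p
  map_add' p r := by
    have h : divDiff i (p + r) = divDiff i p + divDiff i r := by
      apply mul_left_cancel₀ (X_sub_X_ne_zero (K := K) i)
      rw [mul_add, mul_divDiff, mul_divDiff, mul_divDiff, map_add]; ring
    rw [h, map_add]; ring
  map_smul' a p := by
    have h : divDiff i (a • p) = a • divDiff i p := by
      apply mul_left_cancel₀ (X_sub_X_ne_zero (K := K) i)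
      rw [mul_smul_comm, mul_divDiff, mul_divDiff, map_smul, smul_sub]
    rw [h, map_smul, RingHom.id_apply, smul_add, mul_smul_comm, mul_smul_comm]

/-- The inverse operator `T_i⁻¹ = (1 / t) (T_i + 1 - t)`; see `opT_mul_opTinv` and
`opTinv_mul_opT`. -/
noncomputable def opTinv {K : Type*} [Field K] {n : ℕ} (t : K) (i : Fin n) :
    Module.End K (MvPolynomial (Fin (n + 1)) K) :=
  t⁻¹ • (opT t i + (1 - t) • 1)

theorem divDiff_unique {K : Type*} [Field K] {n : ℕ} (i : Fin n)
    {p d : MvPolynomial (Fin (n + 1)) K}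
    (h : (X i.castSucc - X i.succ) * d = p - rename (adj i) p) : divDiff i p = d :=
  mul_left_cancel₀ (X_sub_X_ne_zero i) ((mul_divDiff i p).trans h.symm)

theorem opT_apply {K : Type*} [Field K] {n : ℕ} (t : K) (i : Fin n)
    (p : MvPolynomial (Fin (n + 1)) K) :
    opT t i p = C (1 - t) * X i.succ * divDiff i p + C t * rename (adj i) p := rfl

theorem opT_quadratic {K : Type*} [Field K] {n : ℕ} (t : K) (i : Fin n) :
    (opT t i + 1) * (opT t i - t • 1) = 0 := by
  refine LinearMap.ext fun p => ?_
  have e1 : adj i i.castSucc = i.succ := Equiv.swap_apply_left _ _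
  have e2 : adj i i.succ = i.castSucc := Equiv.swap_apply_right _ _
  have hs : rename (adj i) (rename (adj i) p) = p := by
    rw [rename_rename]
    have : (adj i : Fin (n + 1) → Fin (n + 1)) ∘ adj i = id := by
      funext k; simp [adj]
    rw [this, rename_id]; rfl
  have hD := mul_divDiff i p
  have hsym : rename (adj i) (divDiff i p) = divDiff i p := by
    apply mul_left_cancel₀ (X_sub_X_ne_zero (K := K) i)
    have h := congrArg (rename (adj i)) hD
    simp only [map_mul, map_sub, rename_X, e1, e2, hs] at h
    linear_combination -h - hD
  have hr : opT t i p - t • p = (X i.succ - C t * X i.castSucc) * divDiff i p := by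
    rw [opT_apply, smul_eq_C_mul, C_sub, C_1]
    linear_combination C t * hD
  have hd : divDiff i ((X i.succ - C t * X i.castSucc) * divDiff i p)
      = -(1 + C t) * divDiff i p := by
    apply divDiff_unique
    simp only [map_mul, map_sub, rename_X, rename_C, e1, e2, hsym]
    ring
  have hgoal : ((opT t i + 1) * (opT t i - t • 1)) p
      = opT t i (opT t i p - t • p) + (opT t i p - t • p) := rfl
  rw [hgoal, hr, opT_apply, hd]
  simp only [map_mul, map_sub, rename_X, rename_C, e1, e2, hsym, map_one]
  simp only [LinearMap.zero_apply]
  ring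

theorem opT_mul_opTinv {K : Type*} [Field K] {n : ℕ} {t : K} (ht : t ≠ 0) (i : Fin n) :
    opT t i * opTinv t i = 1 := by
  have h := opT_quadratic t i
  have h2 : opT t i * (opT t i + (1 - t) • 1) = t • 1 := by
    rw [add_mul, mul_sub, mul_sub, one_mul, one_mul, mul_smul_comm, mul_one] at h
    rw [mul_add, mul_smul_comm, mul_one, ← sub_eq_zero, ← h]
    module
  rw [opTinv, mul_smul_comm, h2, smul_smul, inv_mul_cancel₀ ht, one_smul]

theorem opTinv_mul_opT {K : Type*} [Field K] {n : ℕ} {t : K} (ht : t ≠ 0) (i : Fin n) :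
    opTinv t i * opT t i = 1 := by
  rw [← opT_mul_opTinv ht i, opTinv, smul_mul_assoc, mul_smul_comm, add_mul, mul_add,
    smul_mul_assoc, mul_smul_comm, one_mul, mul_one]

/-- `f ↦ f T_{N-1} T_{N-2} ⋯ T_1`. -/
noncomputable def prodT {K : Type*} [Field K] (n : ℕ) (t : K) :
    Module.End K (MvPolynomial (Fin (n + 1)) K) :=
  ((List.finRange n).map (opT t)).prod

/-- `f ↦ f T_{N-1}⁻¹ T_{N-2}⁻¹ ⋯ T_1⁻¹`. -/
noncomputable def prodTinv {K : Type*} [Field K] (n : ℕ) (t : K) :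
    Module.End K (MvPolynomial (Fin (n + 1)) K) :=
  ((List.finRange n).map (opTinv t)).prod

/-! ### Shift, Cherednik and Dunkl operators -/

/-- The shift `(f w)(x) = f(q x_N, x_1, …, x_{N-1})`. -/
noncomputable def opW {K : Type*} [Field K] (n : ℕ) (q : K) :
    Module.End K (MvPolynomial (Fin (n + 1)) K) :=
  (aeval (Fin.cons (C q * X (Fin.last n)) fun j : Fin n => X j.castSucc) :
    MvPolynomial (Fin (n + 1)) K →ₐ[K] MvPolynomial (Fin (n + 1)) K).toLinearMap

/-- The Cherednik operator `f ξ_N = t^{N-1} f T_{N-1}⁻¹ ⋯ T_1⁻¹ w`. -/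
noncomputable def opXi {K : Type*} [Field K] (n : ℕ) (q t : K) :
    Module.End K (MvPolynomial (Fin (n + 1)) K) :=
  t ^ n • (opW n q * prodTinv n t)

/-- The Dunkl operator `f D_N = (f - f ξ_N) / x_N`. The division is exact, see `X_mul_opD`. -/
noncomputable def opD {K : Type*} [Field K] (n : ℕ) (q t : K)
    (f : MvPolynomial (Fin (n + 1)) K) : MvPolynomial (Fin (n + 1)) K :=
  (f - opXi n q t f).divMonomial (Finsupp.single (Fin.last n) 1)

/-- `f w^* = f T_{N-1}⁻¹ ⋯ T_1⁻¹ w T_{N-1} ⋯ T_1`. -/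
noncomputable def opWstar {K : Type*} [Field K] (n : ℕ) (q t : K) :
    Module.End K (MvPolynomial (Fin (n + 1)) K) :=
  prodT n t * opW n q * prodTinv n t

theorem opTinv_vanish {K : Type*} [Field K] {n : ℕ} {t : K} (ht : t ≠ 0) (i : Fin n)
    (g : MvPolynomial (Fin (n + 1)) K) :
    (X i.castSucc : MvPolynomial (Fin (n + 1)) K) ∣ t • opTinv t i g - rename (adj i) g := by
  refine ⟨(1 - C t) * divDiff i g, ?_⟩
  have e : t • opTinv t i g = opT t i g + (1 - t) • g := by
    have : opTinv t i g = t⁻¹ • (opT t i g + (1 - t) • g) := rfl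
    rw [this, smul_smul, mul_inv_cancel₀ ht, one_smul]
  rw [e, opT_apply, smul_eq_C_mul, C_sub, C_1]
  linear_combination -(1 - C t) * mul_divDiff i g

theorem prodTinv_vanish {K : Type*} [Field K] {n : ℕ} {t : K} (ht : t ≠ 0)
    (f : MvPolynomial (Fin (n + 1)) K) (m j : ℕ) (hj : j + m = n) :
    ∃ σ : Fin (n + 1) → Fin (n + 1),
      σ (Fin.last n) = ⟨j, by omega⟩ ∧
      (∀ k : Fin n, j ≤ k → σ k.castSucc = k.succ) ∧
      (∀ k : Fin n, (k : ℕ) < j → σ k.castSucc = k.castSucc) ∧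
      (X ⟨j, by omega⟩ : MvPolynomial (Fin (n + 1)) K) ∣
        t ^ m • (((List.finRange n).drop j).map (opTinv t)).prod f - rename σ f := by
  induction m generalizing j with
  | zero =>
    refine ⟨id, ?_, ?_, fun _ _ => rfl, ?_⟩
    · ext; simp; omega
    · intro k hk; have := k.isLt; omega
    · rw [List.drop_eq_nil_of_le (by simp; omega)]
      simp [rename_id]
  | succ m ih =>
    obtain ⟨σ, h1, h2, h3, h4⟩ := ih (j + 1) (by omega)
    have hjn : j < n := by omega
    have a1 : ∀ k : Fin (n + 1), (k : ℕ) ≠ j → (k : ℕ) ≠ j + 1 → adj ⟨j, hjn⟩ k = k := by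
      intro k hk hk'
      apply Equiv.swap_apply_of_ne_of_ne
      · intro h; apply hk; rw [h]; rfl
      · intro h; apply hk'; rw [h]; rfl
    have a2 : adj ⟨j, hjn⟩ ⟨j, by omega⟩ = (⟨j + 1, by omega⟩ : Fin (n + 1)) :=
      Equiv.swap_apply_left _ _
    have a3 : adj ⟨j, hjn⟩ ⟨j + 1, by omega⟩ = (⟨j, by omega⟩ : Fin (n + 1)) :=
      Equiv.swap_apply_right _ _
    refine ⟨adj ⟨j, hjn⟩ ∘ σ, ?_, ?_, ?_, ?_⟩
    · rw [Function.comp_apply, h1, a3]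
    · intro k hk
      rw [Function.comp_apply]
      rcases hk.eq_or_lt with hk | hk
      · rw [h3 k (by omega)]
        have e : k = ⟨j, hjn⟩ := Fin.ext hk.symm
        subst e
        exact a2
      · rw [h2 k hk]
        apply a1 <;> simp only [Fin.val_succ] <;> omega
    · intro k hk
      rw [Function.comp_apply, h3 k (by omega)]
      apply a1 <;> simp only [Fin.val_castSucc] <;> omega
    · have hd : (List.finRange n).drop j = ⟨j, hjn⟩ :: (List.finRange n).drop (j + 1) := by
        rw [List.drop_eq_getElem_cons (by simpa using hjn)]
        simp
      rw [hd, List.map_cons, List.prod_cons]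
      set g := (((List.finRange n).drop (j + 1)).map (opTinv t)).prod f with hg
      have hv := opTinv_vanish ht ⟨j, hjn⟩ (t ^ m • g)
      have hm := map_dvd (rename (R := K) (adj (⟨j, hjn⟩ : Fin n))) h4
      rw [rename_X, a3, map_sub, rename_rename] at hm
      have e : t ^ (m + 1) • (opTinv t ⟨j, hjn⟩ * (((List.finRange n).drop (j + 1)).map
          (opTinv t)).prod) f = t • opTinv t ⟨j, hjn⟩ (t ^ m • g) := by
        rw [map_smul, smul_smul, pow_succ', hg]; rfl
      rw [e]
      have := dvd_add hv hm
      rwa [sub_add_sub_cancel] at this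

theorem X_mul_opD {K : Type*} [Field K] (n : ℕ) (q : K) {t : K} (ht : t ≠ 0)
    (f : MvPolynomial (Fin (n + 1)) K) :
    X (Fin.last n) * opD n q t f = f - opXi n q t f := by
  suffices h : (X (Fin.last n) : MvPolynomial (Fin (n + 1)) K) ∣ f - opXi n q t f by
    obtain ⟨d, hd⟩ := h
    rw [opD, hd, X_mul_divMonomial]
  obtain ⟨σ, h1, h2, -, h4⟩ := prodTinv_vanish ht f n 0 (by omega)
  set W : MvPolynomial (Fin (n + 1)) K →ₐ[K] MvPolynomial (Fin (n + 1)) K :=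
    aeval (Fin.cons (C q * X (Fin.last n)) fun j : Fin n => X j.castSucc) with hW
  have hxi : opXi n q t f = W (t ^ n • prodTinv n t f) := by
    rw [map_smul]; rfl
  have hm := map_dvd W h4
  rw [map_sub, List.drop_zero] at hm
  change W (X 0) ∣ W (t ^ n • prodTinv n t f) - _ at hm
  rw [← hxi] at hm
  have hW0 : W (X 0) = C q * X (Fin.last n) := by rw [hW, aeval_X]; rfl
  have hWs : ∀ j : Fin n, W (X j.succ) = X j.castSucc := by
    intro j; rw [hW, aeval_X]; rfl
  rw [hW0] at hm
  have hk : ∀ p : MvPolynomial (Fin (n + 1)) K,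
      (X (Fin.last n) : MvPolynomial (Fin (n + 1)) K) ∣ p - W (rename σ p) := by
    intro p
    induction p using MvPolynomial.induction_on with
    | C a => simp [hW]
    | add p r hp hr =>
      rw [map_add, map_add, add_sub_add_comm]
      exact dvd_add hp hr
    | mul_X p k hp =>
      have hX : (X (Fin.last n) : MvPolynomial (Fin (n + 1)) K) ∣ X k - W (X (σ k)) := by
        induction k using Fin.lastCases with
        | last =>
          rw [h1]
          change _ ∣ _ - W (X 0)
          rw [hW0]
          exact dvd_sub dvd_rfl (dvd_mul_left _ _)
        | cast k =>
          rw [h2 k (Nat.zero_le _), hWs, sub_self]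
          exact dvd_zero _
      have e : p * X k - W (rename σ (p * X k))
          = (p - W (rename σ p)) * X k + W (rename σ p) * (X k - W (X (σ k))) := by
        rw [map_mul, map_mul, rename_X]; ring
      rw [e]
      exact dvd_add (hp.mul_right _) (hX.mul_left _)
  have := dvd_sub (hk f) ((dvd_mul_left _ _).trans hm)
  rwa [sub_sub_sub_cancel_right] at this

/-- The hypotheses (BF1) on a symmetric bilinear form on `K[x_1, …, x_N]`. -/
structure BF1 {K : Type*} [Field K] {n : ℕ} (q t : K)
    (B : LinearMap.BilinForm K (MvPolynomial (Fin (n + 1)) K)) : Prop where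
  symm : ∀ f g, B f g = B g f
  one_one : B 1 1 = 1
  opT_adjoint : ∀ (i : Fin n) (f g), B (opT t i f) g = B f (opT t i g)
  opXi_adjoint : ∀ f g, B (opXi n q t f) g = B f (opXi n q t g)
  opD_adjoint : ∀ f g,
    B (opD n q t f) g = (1 - q) * B f (X (Fin.last n) * opW n q (opWstar n q t g))

/-! ### Nonsymmetric Macdonald polynomials -/

/-- The rank `r_α(i) = #{j : α_j > α_i} + #{j ≤ i : α_j = α_i}`. -/
def rank {n : ℕ} (α : Fin (n + 1) → ℕ) (i : Fin (n + 1)) : ℕ :=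
  (Finset.univ.filter fun j => α i < α j).card +
    (Finset.univ.filter fun j => j ≤ i ∧ α j = α i).card

/-- The spectral vector `ζ_α(i) = q^{α_i} t^{N - r_α(i)}`. -/
noncomputable def zeta {K : Type*} [Field K] {n : ℕ} (q t : K) (α : Fin (n + 1) → ℕ)
    (i : Fin (n + 1)) : K :=
  q ^ α i * t ^ (((n + 1 : ℕ) : ℤ) - (rank α i : ℤ))

/-- `IsMacdonald q t α p`: the polynomial `p` is the nonsymmetric Macdonald polynomial `M_α`, generated
along the Yang–Baxter graph: `M_0 = 1`; if `α_i < α_{i+1}` then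
`M_{α.s_i} = M_α T_i + (1 - t) / (1 - ζ_α(i+1) / ζ_α(i)) M_α`; and `M_{αΦ} = x_N (M_α w)` for
`αΦ = (α_2, …, α_N, α_1 + 1)`. -/
inductive IsMacdonald {K : Type*} [Field K] {n : ℕ} (q t : K) :
    (Fin (n + 1) → ℕ) → MvPolynomial (Fin (n + 1)) K → Prop
  | root : IsMacdonald q t 0 1
  | step {α : Fin (n + 1) → ℕ} {p : MvPolynomial (Fin (n + 1)) K} (i : Fin n)
      (hi : α i.castSucc < α i.succ) (hp : IsMacdonald q t α p) :
      IsMacdonald q t (α ∘ adj i)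
        (opT t i p + ((1 - t) / (1 - zeta q t α i.succ / zeta q t α i.castSucc)) • p)
  | affine {α : Fin (n + 1) → ℕ} {p : MvPolynomial (Fin (n + 1)) K}
      (hp : IsMacdonald q t α p) :
      IsMacdonald q t (Fin.snoc (Fin.tail α) (α 0 + 1)) (X (Fin.last n) * opW n q p)

/-- Every composition is the label of a node of the Yang–Baxter graph. -/
theorem exists_isMacdonald {K : Type*} [Field K] {n : ℕ} (q t : K) (α : Fin (n + 1) → ℕ) :
    ∃ p, IsMacdonald q t α p := by
  obtain ⟨d, hd⟩ : ∃ d, d = ∑ i, α i := ⟨_, rfl⟩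
  induction d generalizing α with
  | zero =>
    have : α = 0 := by
      funext i
      exact (Finset.sum_eq_zero_iff.mp hd.symm) i (Finset.mem_univ i)
    exact ⟨1, this ▸ IsMacdonald.root⟩
  | succ d ih =>
    have key : ∀ (m : ℕ) (k : Fin (n + 1)) (β : Fin (n + 1) → ℕ), (k : ℕ) + m = n → β k ≠ 0 →
        (∀ j, k < j → β j = 0) → d + 1 = ∑ i, β i → ∃ p, IsMacdonald q t β p := by
      intro m
      induction m with
      | zero =>
        intro k β hk h0 _ hs
        have e : k = Fin.last n := Fin.ext (by simpa using hk)
        subst e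
        obtain ⟨p, hp⟩ := ih (Fin.cons (β (Fin.last n) - 1) (Fin.init β)) (by
          rw [Fin.sum_univ_castSucc] at hs
          rw [Fin.sum_univ_succ]
          simp only [Fin.cons_zero, Fin.cons_succ, Fin.init]
          omega)
        have := hp.affine
        rw [Fin.tail_cons, Fin.cons_zero, Nat.sub_add_cancel (Nat.one_le_iff_ne_zero.mpr h0),
          Fin.snoc_init_self] at this
        exact ⟨_, this⟩
      | succ m ihm =>
        intro k β hk h0 hz hs
        have hkn : (k : ℕ) < n := by omega
        obtain ⟨i, rfl⟩ : ∃ i : Fin n, k = i.castSucc := ⟨⟨k, hkn⟩, rfl⟩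
        have e1 : adj i i.castSucc = i.succ := Equiv.swap_apply_left _ _
        have e2 : adj i i.succ = i.castSucc := Equiv.swap_apply_right _ _
        have hi0 : β i.succ = 0 := hz _ Fin.castSucc_lt_succ
        obtain ⟨p, hp⟩ := ihm i.succ (β ∘ adj i)
          (by simp only [Fin.val_castSucc] at hk; simp only [Fin.val_succ]; omega)
          (by rw [Function.comp_apply, e2]; exact h0)
          (by
            intro j hj
            have hj' : adj i j = j := by
              apply Equiv.swap_apply_of_ne_of_ne
              · exact (Fin.castSucc_lt_succ.trans hj).ne'
              · exact hj.ne'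
            rw [Function.comp_apply, hj']
            exact hz j (Fin.castSucc_lt_succ.trans hj))
          (by rw [hs]; exact (Equiv.sum_comp (adj i) β).symm)
        have hst := hp.step i (by
          rw [Function.comp_apply, Function.comp_apply, e1, e2, hi0]
          exact Nat.pos_of_ne_zero h0)
        have hb : (β ∘ adj i) ∘ adj i = β := by
          funext x; simp [adj]
        rw [hb] at hst
        exact ⟨_, hst⟩
    have hne : (Finset.univ.filter fun i => α i ≠ 0).Nonempty := by
      by_contra h
      rw [Finset.not_nonempty_iff_eq_empty, Finset.filter_eq_empty_iff] at h
      have : ∑ i, α i = 0 := Finset.sum_eq_zero fun i hi => by simpa using h hi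
      omega
    set k := (Finset.univ.filter fun i => α i ≠ 0).max' hne with hkdef
    have hk := Finset.max'_mem _ hne
    rw [← hkdef, Finset.mem_filter] at hk
    refine key (n - k) k α (by have := k.isLt; omega) hk.2 ?_ hd
    intro j hj
    by_contra h
    have := Finset.le_max' (Finset.univ.filter fun i => α i ≠ 0) j (by simpa using h)
    exact absurd hj (not_lt.mpr this)

/-! ### Ingredients of the norm formula -/

/-- The hook product `∏_{(i,j) ∈ λ} (1 - z q^{arm(i,j)} t^{leg(i,j)})` of a partition `λ`, with
`arm(i,j) = λ_i - j` and `leg(i,j) = λ'_j - i`, where `λ'_j = #{k : λ_k ≥ j}`; the code numbers rows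
and columns from `0`. -/
noncomputable def hook {K : Type*} [Field K] {n : ℕ} (q t : K) (lam : Fin (n + 1) → ℕ) (z : K) : K :=
  ∏ i : Fin (n + 1), ∏ j ∈ Finset.range (lam i),
    (1 - z * q ^ (lam i - (j + 1)) *
      t ^ ((Finset.univ.filter fun k => j + 1 ≤ lam k).card - ((i : ℕ) + 1)))

/-- `(z; q)_m = ∏_{i=1}^m (1 - z q^{i-1})`. -/
def qPoch {K : Type*} [Field K] (z q : K) (m : ℕ) : K :=
  ∏ i ∈ Finset.range m, (1 - z * q ^ i)

/-- `(z; q, t)_λ = ∏_{i=1}^N (z t^{1-i}; q)_{λ_i}`. -/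
noncomputable def qtPoch {K : Type*} [Field K] {n : ℕ} (z q t : K) (lam : Fin (n + 1) → ℕ) : K :=
  ∏ i : Fin (n + 1), qPoch (z * t ^ (-((i : ℕ) : ℤ))) q (lam i)

/-- `k(λ) = ∑_{i=1}^N (N - 2 i + 1) λ_i`. -/
def kExp {n : ℕ} (lam : Fin (n + 1) → ℕ) : ℤ :=
  ∑ i : Fin (n + 1), (((n + 1 : ℕ) : ℤ) - 2 * (((i : ℕ) : ℤ) + 1) + 1) * (lam i : ℤ)

end Macdonald

namespace Macdonald

/-! ### Relations between the Demazure–Lusztig operators -/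

section Relations

variable {K : Type*} [Field K] {n : ℕ}

/-! The squared norms obey one recursion for each kind of edge of the Yang–Baxter graph, and a
closed formula, extended to all compositions, satisfies the same recursions.

The operators `T_i` satisfy the braid relations, so the Cherednik operators `ξ_i`, obtained from
`ξ_N` by `ξ_i = t⁻¹ T_i ξ_{i+1} T_i`, commute with every `T_j` not touching position `i`, and the
affine map `Φ : f ↦ x_N (f w)` shifts their indices cyclically with a factor `q` on wrapping around.
Hence each `M_α` is a simultaneous eigenvector with eigenvalues `ζ_α(i)`
(`IsMacdonald.cherednik_apply`).

Under (BF1) all `ξ_i` are selfadjoint. For `α_i < α_{i+1}` the vectors `M_α` and `M_{α.s_i}` have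
different `ξ_i`-eigenvalues, so they are orthogonal; with the quadratic relation this multiplies the
norm by `stepFactor t z`, `z = ζ_α(i+1)/ζ_α(i)` (`BF1.step_norm`). The condition on `D_N` gives `(1
- q) ‖M_{αΦ}‖² = (1 - q ζ_α(1)) ‖M_α‖²` (`BF1.affine_norm`).

Let `normValue` be the asserted expression with row indices replaced by ranks, so that it is
unchanged by a step, and let `inversionProd` be the product of step factors over the inversions of
`α`. Induction along the graph yields `inversionProd α * ‖M_α‖² = normValue α`: a step removes
exactly one inversion, and the affine edge is the combinatorial identity `normValue_affine`. A
partition has no inversions, which leaves the claim. As the induction runs over derivations,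
independence of `M_α` from the path is never needed. -/

theorem adj_castSucc (i : Fin n) : adj i i.castSucc = i.succ := Equiv.swap_apply_left _ _

theorem adj_succ (i : Fin n) : adj i i.succ = i.castSucc := Equiv.swap_apply_right _ _

theorem adj_of_ne {i : Fin n} {k : Fin (n + 1)} (h1 : k ≠ i.castSucc) (h2 : k ≠ i.succ) :
    adj i k = k := Equiv.swap_apply_of_ne_of_ne h1 h2

theorem adj_adj (i : Fin n) (k : Fin (n + 1)) : adj i (adj i k) = k := by simp [adj]

theorem rename_adj_adj (i : Fin n) (p : MvPolynomial (Fin (n + 1)) K) :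
    rename (adj i) (rename (adj i) p) = p := by
  rw [rename_rename]
  have : (adj i : Fin (n + 1) → Fin (n + 1)) ∘ adj i = id := funext (adj_adj i)
  rw [this, rename_id]; rfl

theorem divDiff_mul_of_invariant (i : Fin n) {f : MvPolynomial (Fin (n + 1)) K}
    (hf : rename (adj i) f = f) (g : MvPolynomial (Fin (n + 1)) K) :
    divDiff i (f * g) = f * divDiff i g := by
  apply divDiff_unique
  rw [map_mul, hf]
  linear_combination f * mul_divDiff i g

theorem opT_mul_of_invariant (t : K) (i : Fin n) {f : MvPolynomial (Fin (n + 1)) K}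
    (hf : rename (adj i) f = f) (g : MvPolynomial (Fin (n + 1)) K) :
    opT t i (f * g) = f * opT t i g := by
  rw [opT_apply, opT_apply, divDiff_mul_of_invariant i hf, map_mul, hf]
  ring

/-- An algebra endomorphism that carries `x_i, x_{i+1}` to a common multiple of `x_k, x_{k+1}` and
`s_i` to `s_k` carries `T_i` to `T_k`. -/
theorem map_opT (t : K) {i k : Fin n}
    (φ : MvPolynomial (Fin (n + 1)) K →ₐ[K] MvPolynomial (Fin (n + 1)) K)
    (c : K) (h1 : φ (X i.castSucc) = C c * X k.castSucc) (h2 : φ (X i.succ) = C c * X k.succ)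
    (hs : ∀ j, φ (X (adj i j)) = rename (adj k) (φ (X j))) (p : MvPolynomial (Fin (n + 1)) K) :
    φ (opT t i p) = opT t k (φ p) := by
  have hs' : φ (rename (adj i) p) = rename (adj k) (φ p) := by
    have : φ.comp (rename (adj i)) = (rename (adj k)).comp φ := by
      ext j : 1
      simpa using hs j
    exact DFunLike.congr_fun this p
  have hd : C c * φ (divDiff i p) = divDiff k (φ p) := by
    symm
    apply divDiff_unique
    rw [← hs', ← map_sub, ← mul_divDiff i p, map_mul, map_sub, h1, h2]
    ring
  rw [opT_apply, opT_apply, ← hd, ← hs', map_add, map_mul, map_mul, map_mul, h2]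
  simp only [← algebraMap_eq, AlgHom.commutes]
  ring

/-- `T_j` is assembled from `s_j`, the divided difference and multiplication by `x_{j+1}`; each
commutes with `T_i`, since `s_j` fixes `x_i, x_{i+1}` and the variables of `T_j` are
`s_i`-invariant. -/
theorem opT_commute_of_lt (t : K) {i j : Fin n} (h : (i : ℕ) + 1 < j) :
    Commute (opT t i) (opT t j) := by
  have hfix : ∀ k : Fin n, (k : ℕ) + 1 < j ∨ (j : ℕ) + 1 < k →
      adj j k.castSucc = k.castSucc ∧ adj j k.succ = k.succ := by
    intro k hk
    constructor <;> apply adj_of_ne <;> simp only [ne_eq, Fin.ext_iff, Fin.val_castSucc,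
      Fin.val_succ] <;> omega
  obtain ⟨f1, f2⟩ := hfix i (Or.inl h)
  have hj1 : adj i j.castSucc = j.castSucc := by
    apply adj_of_ne <;> simp only [ne_eq, Fin.ext_iff, Fin.val_castSucc, Fin.val_succ] <;> omega
  have hj2 : adj i j.succ = j.succ := by
    apply adj_of_ne <;> simp only [ne_eq, Fin.ext_iff, Fin.val_castSucc, Fin.val_succ] <;> omega
  have hcomm : ∀ x, adj i (adj j x) = adj j (adj i x) := by
    intro x
    by_cases h1 : x = i.castSucc
    · rw [h1, f1, adj_castSucc, f2]
    by_cases h2 : x = i.succ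
    · rw [h2, f2, adj_succ, f1]
    rw [adj_of_ne h1 h2]
    by_cases h3 : x = j.castSucc
    · rw [h3, adj_castSucc, hj2]
    by_cases h4 : x = j.succ
    · rw [h4, adj_succ, hj1]
    · rw [adj_of_ne h3 h4, adj_of_ne h1 h2]
  have hsT : ∀ p : MvPolynomial (Fin (n + 1)) K,
      rename (adj j) (opT t i p) = opT t i (rename (adj j) p) := by
    intro p
    refine map_opT t (rename (adj j)) 1 ?_ ?_ ?_ p
    · rw [rename_X, f1]; simp
    · rw [rename_X, f2]; simp
    · intro x; simp only [rename_X, hcomm]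
  have hD : ∀ p : MvPolynomial (Fin (n + 1)) K,
      divDiff j (opT t i p) = opT t i (divDiff j p) := by
    intro p
    apply divDiff_unique
    rw [hsT, ← map_sub, ← mul_divDiff j p, opT_mul_of_invariant]
    rw [map_sub, rename_X, rename_X, hj1, hj2]
  refine LinearMap.ext fun p => ?_
  change opT t i (opT t j p) = opT t j (opT t i p)
  rw [opT_apply t j (opT t i p), hD, hsT, opT_apply t j p, map_add, mul_assoc, mul_assoc,
    opT_mul_of_invariant, opT_mul_of_invariant, opT_mul_of_invariant]
  · simp
  · rw [rename_X, hj2]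
  · simp

theorem opT_commute (t : K) {i j : Fin n} (h : (i : ℕ) + 1 < j ∨ (j : ℕ) + 1 < i) :
    Commute (opT t i) (opT t j) :=
  h.elim (opT_commute_of_lt t) fun h => (opT_commute_of_lt t h).symm

/-- Eliminates the divided difference, so that over the fraction field `T_i p` is an explicit
combination of `p` and `p.s_i`. -/
theorem mul_opT (t : K) (i : Fin n) (p : MvPolynomial (Fin (n + 1)) K) :
    (X i.castSucc - X i.succ) * opT t i p =
      (1 - C t) * X i.succ * p + (C t * X i.castSucc - X i.succ) * rename (adj i) p := by
  rw [opT_apply, C_sub, C_1]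
  linear_combination (1 - C t) * X i.succ * mul_divDiff i p

/-- The braid relation `T_i T_{i+1} T_i = T_{i+1} T_i T_{i+1}` in coordinates: `a, b, c` are three
consecutive variables and `p₁, …, p₆` the images of a polynomial under their permutations. -/
theorem braid_identity {L : Type*} [Field L] {a b c : L} (k1 : a - b ≠ 0) (k2 : b - c ≠ 0)
    (k3 : a - c ≠ 0) (r p1 p2 p3 p4 p5 p6 : L) :
    ((1 - r) * b *
            (((1 - r) * c * (((1 - r) * b * p1 + (r * a - b) * p2) / (a - b)) +
                (r * b - c) * (((1 - r) * c * p3 + (r * a - c) * p4) / (a - c))) /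
              (b - c)) +
          (r * a - b) *
            (((1 - r) * c * (((1 - r) * a * p2 + (r * b - a) * p1) / (b - a)) +
                (r * a - c) * (((1 - r) * c * p5 + (r * b - c) * p6) / (b - c))) /
              (a - c))) /
        (a - b) =
      ((1 - r) * c *
            (((1 - r) * b * (((1 - r) * c * p1 + (r * b - c) * p3) / (b - c)) +
                (r * a - b) * (((1 - r) * c * p2 + (r * a - c) * p5) / (a - c))) /
              (a - b)) +
          (r * b - c) *
            (((1 - r) * c * (((1 - r) * b * p3 + (r * c - b) * p1) / (c - b)) +
                (r * a - c) * (((1 - r) * b * p4 + (r * a - b) * p6) / (a - b))) /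
              (a - c))) /
        (b - c) := by
  -- In terms of the gaps `u = a - b` and `v = b - c` the denominators are just `u`, `v` and `u +
  -- v`.
  obtain ⟨u, rfl⟩ : ∃ u, a = b + u := ⟨a - b, by ring⟩
  obtain ⟨v, rfl⟩ : ∃ v, c = b - v := ⟨b - c, by ring⟩
  have e1 : b - (b + u) = -u := by ring
  have e2 : b - v - b = -v := by ring
  have e3 : b + u - (b - v) = u + v := by ring
  rw [e3] at k3
  rw [e1, e2, e3]
  simp only [add_sub_cancel_left, sub_sub_cancel] at k1 k2 ⊢
  field_simp
  ring

/-- In the fraction field both sides are combinations of the six images of `p` under permutations of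
three variables, and the coefficients are compared in `braid_identity`. -/
theorem opT_braid (t : K) {i j : Fin n} (h : (j : ℕ) = i + 1) :
    opT t i * opT t j * opT t i = opT t j * opT t i * opT (K := K) t j := by
  refine LinearMap.ext fun p => ?_
  change opT t i (opT t j (opT t i p)) = opT t j (opT t i (opT t j p))
  have hm : j.castSucc = i.succ := Fin.ext (by simp [h])
  have i1 := adj_castSucc i
  have i2 := adj_succ i
  have i3 : adj i j.succ = j.succ := by
    apply adj_of_ne <;> simp only [ne_eq, Fin.ext_iff, Fin.val_castSucc, Fin.val_succ] <;> omega
  have j1 : adj j i.castSucc = i.castSucc := by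
    apply adj_of_ne <;> simp only [ne_eq, Fin.ext_iff, Fin.val_castSucc, Fin.val_succ] <;> omega
  have j2 := adj_castSucc j
  have j3 := adj_succ j
  rw [hm] at j2 j3
  have hbr : ∀ r : MvPolynomial (Fin (n + 1)) K,
      rename (adj j) (rename (adj i) (rename (adj j) r)) =
        rename (adj i) (rename (adj j) (rename (adj i) r)) := by
    intro r
    simp only [rename_rename]
    refine congrArg (fun f => rename f r) ?_
    refine funext fun x => ?_
    simp only [Function.comp_apply]
    by_cases h1 : x = i.castSucc
    · simp only [h1, i1, j1, j2, i3]
    by_cases h2 : x = i.succ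
    · simp only [h2, i1, i2, j1, j2, i3, j3]
    by_cases h3 : x = j.succ
    · simp only [h3, i2, j1, i3, j3]
    · rw [adj_of_ne (hm ▸ h2 : x ≠ j.castSucc) h3, adj_of_ne h1 h2,
        adj_of_ne (hm ▸ h2 : x ≠ j.castSucc) h3, adj_of_ne h1 h2]
  have d1 := X_sub_X_ne_zero (K := K) i
  have d2 := X_sub_X_ne_zero (K := K) j
  have d3 : (X i.castSucc - X j.succ : MvPolynomial (Fin (n + 1)) K) ≠ 0 := by
    intro h0
    have := Fin.ext_iff.mp (X_injective (R := K) (sub_eq_zero.mp h0))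
    simp only [Fin.val_castSucc, Fin.val_succ] at this
    omega
  have eI : ∀ r, _ := mul_opT (K := K) t i
  have eJ : ∀ r, _ := mul_opT (K := K) t j
  rw [hm] at d2
  simp only [hm] at eJ
  have sI : ∀ {u v : MvPolynomial (Fin (n + 1)) K}, u = v → rename (adj i) u = rename (adj i) v :=
    fun h => congrArg _ h
  have sJ : ∀ {u v : MvPolynomial (Fin (n + 1)) K}, u = v → rename (adj j) u = rename (adj j) v :=
    fun h => congrArg _ h
  -- With operators composed from right to left, `a1`, …, `a6` and `a0` describe `T_i p`, `s_j T_i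
  -- p`, `s_i s_j T_i p`, `T_j T_i p`, `s_i T_j T_i p`, `T_i T_j T_i p` and `s_i T_i p`; the `b`s do
  -- the same with `i` and `j` exchanged.
  have a1 := eI p
  have a2 := sJ a1
  have a3 := sI a2
  have a4 := eJ (opT t i p)
  have a5 := sI a4
  have a6 := eI (opT t j (opT t i p))
  have b1 := eJ p
  have b2 := sI b1
  have b3 := sJ b2
  have b4 := eI (opT t j p)
  have b5 := sJ b4
  have b6 := eJ (opT t i (opT t j p))
  have a0 := sI a1
  have b0 := sJ b1
  simp only [map_mul, map_sub, map_add, map_one, rename_X, rename_C, i1, i2, i3, j1, j2, j3,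
    rename_adj_adj, hbr] at a0 a2 a3 a5 b0 b2 b3 b5
  let ι := algebraMap (MvPolynomial (Fin (n + 1)) K) (FractionRing (MvPolynomial (Fin (n + 1)) K))
  have hι : Function.Injective ι := IsFractionRing.injective _ _
  apply hι
  have solve : ∀ {d u v : MvPolynomial (Fin (n + 1)) K}, d ≠ 0 → d * u = v → ι u = ι v / ι d := by
    intro d u v hd h
    rw [eq_div_iff ((map_ne_zero_iff ι hι).mpr hd), ← map_mul, ← h, mul_comm]
  have k1 := (map_ne_zero_iff ι hι).mpr d1
  have k2 := (map_ne_zero_iff ι hι).mpr d2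
  have k3 := (map_ne_zero_iff ι hι).mpr d3
  have d1' : (X i.succ - X i.castSucc : MvPolynomial (Fin (n + 1)) K) ≠ 0 := by
    rw [← neg_sub]; exact neg_ne_zero.mpr d1
  have d2' : (X j.succ - X i.succ : MvPolynomial (Fin (n + 1)) K) ≠ 0 := by
    rw [← neg_sub]; exact neg_ne_zero.mpr d2
  replace a0 := solve d1' a0
  replace a1 := solve d1 a1
  replace a2 := solve d3 a2
  replace a3 := solve d2 a3
  replace a4 := solve d2 a4
  replace a5 := solve d3 a5
  replace a6 := solve d1 a6
  replace b0 := solve d2' b0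
  replace b1 := solve d2 b1
  replace b2 := solve d3 b2
  replace b3 := solve d1 b3
  replace b4 := solve d1 b4
  replace b5 := solve d3 b5
  replace b6 := solve d2 b6
  simp only [map_mul, map_sub, map_add, map_one] at a0 a1 a2 a3 a4 a5 a6
  simp only [map_mul, map_sub, map_add, map_one] at b0 b1 b2 b3 b4 b5 b6 k1 k2 k3
  rw [a6, b6, a5, b5, a4, b4, a3, b3, a2, b2, a1, b1, a0, b0]
  generalize ι (rename (adj i) (rename (adj j) (rename (adj i) p))) = p6
  generalize ι (rename (adj i) (rename (adj j) p)) = p5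
  generalize ι (rename (adj j) (rename (adj i) p)) = p4
  generalize ι (rename (adj j) p) = p3
  generalize ι (rename (adj i) p) = p2
  generalize ι p = p1
  generalize ι (X i.castSucc) = a at *
  generalize ι (X i.succ) = b at *
  generalize ι (X j.succ) = c at *
  generalize ι (C t) = r
  exact braid_identity k1 k2 k3 r p1 p2 p3 p4 p5 p6

theorem opT_opT_apply (t : K) (i : Fin n) (p : MvPolynomial (Fin (n + 1)) K) :
    opT t i (opT t i p) = (t - 1) • opT t i p + t • p := by
  have hq := LinearMap.congr_fun (opT_quadratic t i) p
  have : opT t i (opT t i p - t • p) + (opT t i p - t • p) = 0 := hq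
  rw [map_sub, map_smul] at this
  rw [← sub_eq_zero, ← this]
  module

/-- `x_i (g T_i) T_i = t x_{i+1} g`. -/
theorem opT_X_mul_opT (t : K) (i : Fin n) (g : MvPolynomial (Fin (n + 1)) K) :
    opT t i (X i.castSucc * opT t i g) = t • (X i.succ * g) := by
  -- Since `T_i + 1 - t = t T_i⁻¹`, this moves `T_i` past `x_i` at the price of inverting it.
  have h : ∀ h, opT t i (X i.castSucc * h) = X i.succ * (opT t i h + (1 - t) • h) := by
    intro h
    have hd : divDiff i (X i.castSucc * h) = h + X i.succ * divDiff i h := by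
      apply divDiff_unique
      rw [map_mul, rename_X, adj_castSucc]
      linear_combination X i.succ * mul_divDiff i h
    rw [opT_apply, opT_apply, hd, map_mul, rename_X, adj_castSucc, smul_eq_C_mul]
    ring
  have hq : opT t i (opT t i g) + (1 - t) • opT t i g = t • g := by
    rw [opT_opT_apply]
    module
  rw [h, hq, mul_smul_comm]

theorem opTinv_opT_apply {t : K} (ht : t ≠ 0) (i : Fin n) (p : MvPolynomial (Fin (n + 1)) K) :
    opTinv t i (opT t i p) = p := by
  rw [← Module.End.mul_apply, opTinv_mul_opT ht, Module.End.one_apply]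

theorem opT_opTinv_apply {t : K} (ht : t ≠ 0) (i : Fin n) (p : MvPolynomial (Fin (n + 1)) K) :
    opT t i (opTinv t i p) = p := by
  rw [← Module.End.mul_apply, opT_mul_opTinv ht, Module.End.one_apply]

theorem opTinv_X_succ_mul {t : K} (ht : t ≠ 0) (i : Fin n) (g : MvPolynomial (Fin (n + 1)) K) :
    opTinv t i (X i.succ * g) = t⁻¹ • (X i.castSucc * opT t i g) := by
  have h := opT_X_mul_opT t i g
  rw [← inv_smul_eq_iff₀ ht, ← map_smul] at h
  rw [← h, opTinv_opT_apply ht, smul_eq_C_mul]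

end Relations

/-! ### The Cherednik operators -/

section Cherednik

variable {K : Type*} [Field K] {n : ℕ}

/-- The shift `w` as an algebra endomorphism. -/
noncomputable def shiftHom (n : ℕ) (q : K) :
    MvPolynomial (Fin (n + 1)) K →ₐ[K] MvPolynomial (Fin (n + 1)) K :=
  aeval (Fin.cons (C q * X (Fin.last n)) fun j : Fin n => X j.castSucc)

theorem opW_eq (q : K) (p : MvPolynomial (Fin (n + 1)) K) : opW n q p = shiftHom n q p := rfl

theorem shiftHom_X_zero (q : K) : shiftHom n q (X 0) = C q * X (Fin.last n) := by
  rw [shiftHom, aeval_X, Fin.cons_zero]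

theorem shiftHom_X_succ (q : K) (j : Fin n) : shiftHom n q (X j.succ) = X j.castSucc := by
  rw [shiftHom, aeval_X, Fin.cons_succ]

theorem opW_mul (q : K) (f g : MvPolynomial (Fin (n + 1)) K) :
    opW n q (f * g) = opW n q f * opW n q g := by
  simp only [opW_eq, map_mul]

theorem opW_X_zero (q : K) : opW n q (X 0) = q • X (Fin.last n) := by
  rw [opW_eq, shiftHom_X_zero, smul_eq_C_mul]

theorem opW_X_succ (q : K) (j : Fin n) : opW n q (X j.succ) = X j.castSucc :=
  shiftHom_X_succ q j

/-- The shift carries `x_{i+1}, x_{i+2}` to `x_i, x_{i+1}`, hence `s_{i+1}` to `s_i`, and `map_opT`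
applies. -/
theorem opW_opT (q t : K) {i j : Fin n} (h : (j : ℕ) = i + 1)
    (p : MvPolynomial (Fin (n + 1)) K) : opW n q (opT t j p) = opT t i (opW n q p) := by
  have hm : j.castSucc = i.succ := Fin.ext (by simp [h])
  rw [opW_eq, opW_eq]
  refine map_opT t (shiftHom n q) 1 ?_ ?_ ?_ p
  · rw [hm, shiftHom_X_succ, C_1, one_mul]
  · rw [shiftHom_X_succ, hm, C_1, one_mul]
  · intro x
    cases x using Fin.cases with
    | zero =>
      have e1 : adj j 0 = 0 := by
        apply adj_of_ne <;> simp only [ne_eq, Fin.ext_iff, Fin.val_castSucc, Fin.val_succ,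
          Fin.val_zero] <;> omega
      have e2 : adj i (Fin.last n) = Fin.last n := by
        apply adj_of_ne <;> simp only [ne_eq, Fin.ext_iff, Fin.val_castSucc, Fin.val_succ,
          Fin.val_last] <;> omega
      rw [e1, shiftHom_X_zero, map_mul, rename_C, rename_X, e2]
    | succ k =>
      rw [shiftHom_X_succ, rename_X]
      by_cases h1 : k = i
      · rw [h1, ← hm, adj_castSucc, shiftHom_X_succ, adj_castSucc, hm]
      by_cases h2 : k = j
      · rw [h2, adj_succ, hm, shiftHom_X_succ, adj_succ]
      · rw [adj_of_ne, adj_of_ne, shiftHom_X_succ]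
        · simpa [Fin.ext_iff] using h1
        · rw [← hm]; simpa [Fin.ext_iff] using h2
        · rw [hm]; simpa [Fin.ext_iff] using h1
        · simpa [Fin.ext_iff] using h2

/-- The wrap-around case: a single shift separates `x_1` from `x_2`, but two shifts carry them to `q
x_{N-1}, q x_N`. This is why `map_opT` allows a common scalar. -/
theorem opW_opW_opT {m : ℕ} (q t : K) (p : MvPolynomial (Fin (m + 1 + 1)) K) :
    opW (m + 1) q (opW (m + 1) q (opT t 0 p)) =
      opT t (Fin.last m) (opW (m + 1) q (opW (m + 1) q p)) := by
  simp only [opW_eq]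
  have wC : ∀ c, shiftHom (m + 1) q (C c) = C c := fun c => (shiftHom (m + 1) q).commutes c
  have h0 : shiftHom (m + 1) q (shiftHom (m + 1) q (X 0)) = C q * X (Fin.last m).castSucc := by
    rw [shiftHom_X_zero, map_mul, wC, ← Fin.succ_last, shiftHom_X_succ]
  have h1 : shiftHom (m + 1) q (shiftHom (m + 1) q (X (Fin.succ 0))) = C q * X (Fin.last m).succ := by
    rw [shiftHom_X_succ, Fin.castSucc_zero, shiftHom_X_zero, Fin.succ_last]
  rw [← AlgHom.comp_apply, ← AlgHom.comp_apply]
  refine map_opT (i := 0) t ((shiftHom (m + 1) q).comp (shiftHom (m + 1) q)) q ?_ ?_ ?_ p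
  · rw [Fin.castSucc_zero, AlgHom.comp_apply, h0]
  · rw [AlgHom.comp_apply, h1]
  intro x
  simp only [AlgHom.comp_apply]
  cases x using Fin.cases with
  | zero =>
    have e : adj (0 : Fin (m + 1)) 0 = Fin.succ 0 := adj_castSucc (0 : Fin (m + 1))
    rw [e, h1, h0, map_mul, rename_C, rename_X, adj_castSucc]
  | succ k =>
    cases k using Fin.cases with
    | zero =>
      rw [adj_succ, h1, Fin.castSucc_zero, h0, map_mul, rename_C, rename_X, adj_succ]
    | succ k =>
      rw [adj_of_ne, shiftHom_X_succ, Fin.castSucc_succ, shiftHom_X_succ, rename_X, adj_of_ne]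
      · have := k.isLt
        simp only [ne_eq, Fin.ext_iff, Fin.val_castSucc, Fin.val_last]; omega
      · have := k.isLt
        simp only [ne_eq, Fin.ext_iff, Fin.val_castSucc, Fin.val_last, Fin.val_succ]; omega
      · simp [Fin.ext_iff]
      · simp [Fin.ext_iff]

theorem commute_opTinv {t : K} {i : Fin n} {A : Module.End K (MvPolynomial (Fin (n + 1)) K)}
    (h : Commute A (opT t i)) : Commute A (opTinv t i) :=
  ((h.add_right ((Commute.one_right A).smul_right _)).smul_right _)

theorem drop_finRange (i : Fin n) :
    (List.finRange n).drop i = i :: (List.finRange n).drop (i + 1) := by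
  rw [List.drop_eq_getElem_cons (by simp)]
  simp

theorem take_finRange (i : Fin n) :
    (List.finRange n).take (i + 1) = (List.finRange n).take i ++ [i] := by
  rw [List.take_add_one]
  simp

/-- The Cherednik operators, `f ξ_i = t^{i-1} f T_{i-1}⁻¹ ⋯ T_1⁻¹ w T_{N-1} ⋯ T_i`. -/
noncomputable def cherednik (n : ℕ) (q t : K) (k : Fin (n + 1)) :
    Module.End K (MvPolynomial (Fin (n + 1)) K) :=
  t ^ (k : ℕ) • ((((List.finRange n).drop k).map (opT t)).prod * opW n q *
    (((List.finRange n).take k).map (opTinv t)).prod)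

theorem cherednik_last (q t : K) : cherednik n q t (Fin.last n) = opXi n q t := by
  rw [cherednik, opXi, Fin.val_last, List.drop_eq_nil_of_le (by simp),
    List.take_of_length_le (by simp), List.map_nil, List.prod_nil, one_mul, prodTinv]

theorem cherednik_zero (q t : K) : cherednik n q t 0 = prodT n t * opW n q := by
  rw [cherednik, prodT, Fin.val_zero, List.drop_zero, List.take_zero, List.map_nil, List.prod_nil,
    mul_one, pow_zero, one_smul]

theorem opWstar_eq (q t : K) : opWstar n q t = cherednik n q t 0 * prodTinv n t := by
  rw [cherednik_zero, opWstar]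

/-- This recursion lets statements about all `ξ_i` be proved downwards from `ξ_N`, the only one that
(BF1) mentions. -/
theorem cherednik_castSucc (q : K) {t : K} (ht : t ≠ 0) (i : Fin n) :
    cherednik n q t i.castSucc =
      t⁻¹ • (opT t i * cherednik n q t i.succ * opT t i) := by
  rw [cherednik, cherednik, Fin.val_castSucc, Fin.val_succ, drop_finRange, take_finRange,
    List.map_append, List.prod_append, List.map_cons, List.prod_cons, List.map_singleton,
    List.prod_singleton]
  simp only [mul_smul_comm, smul_mul_assoc, mul_assoc, opTinv_mul_opT ht, smul_smul, mul_one]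
  congr 1
  rw [pow_succ']
  field_simp

/-- The product `T_{N-1}⁻¹ ⋯ T_k⁻¹` intertwines `T_i` and `T_{i+1}` for `k ≤ i`. -/
theorem prod_opTinv_commute {t : K} (ht : t ≠ 0) {i j : Fin n} (h : (j : ℕ) = i + 1) (k : ℕ)
    (hk : k ≤ i) :
    (((List.finRange n).drop k).map (opTinv t)).prod * opT t i =
      opT t j * (((List.finRange n).drop k).map (opTinv t)).prod := by
  obtain ⟨d, hd⟩ := Nat.exists_eq_add_of_le hk
  induction d generalizing k with
  | zero =>
    obtain rfl : k = i := by omega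
    rw [drop_finRange, ← h, drop_finRange]
    have hc : Commute (opT t i)
        (((List.finRange n).drop (j + 1)).map (opTinv t)).prod := by
      apply Commute.list_prod_right
      intro A hA
      obtain ⟨l, hl, rfl⟩ := List.mem_map.mp hA
      apply commute_opTinv
      apply opT_commute
      left
      obtain ⟨a, ha, rfl⟩ := List.mem_drop_iff_getElem.mp hl
      simp
      omega
    simp only [List.map_cons, List.prod_cons]
    set P := (((List.finRange n).drop (j + 1)).map (opTinv t)).prod
    -- The braid relation conjugated by inverses; the later factors have index at least `i + 2` and
    -- commute with `T_i`.
    have hb : opTinv t i * opTinv t j * opT t i = opT t j * (opTinv t i * opTinv t j) := by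
      have hbr := opT_braid t h (K := K)
      calc opTinv t i * opTinv t j * opT t i
          = opTinv t i * opTinv t j * (opT t i * opT t j * opT t i) *
              opTinv t i * opTinv t j := by
            simp only [mul_assoc]
            rw [← mul_assoc (opT t i) (opTinv t i), opT_mul_opTinv ht, one_mul,
              opT_mul_opTinv ht, mul_one]
        _ = opT t j * (opTinv t i * opTinv t j) := by
            rw [hbr]
            simp only [mul_assoc]
            rw [← mul_assoc (opTinv t j) (opT t j), opTinv_mul_opT ht, one_mul,
              ← mul_assoc (opTinv t i) (opT t i), opTinv_mul_opT ht, one_mul]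
    calc opTinv t i * (opTinv t j * P) * opT t i
        = opTinv t i * opTinv t j * (P * opT t i) := by simp only [mul_assoc]
      _ = (opTinv t i * opTinv t j * opT t i) * P := by rw [← hc.eq]; simp only [mul_assoc]
      _ = opT t j * (opTinv t i * (opTinv t j * P)) := by rw [hb]; simp only [mul_assoc]
  | succ d ih =>
    have hkn : k < n := by omega
    have hdrop := drop_finRange (⟨k, hkn⟩ : Fin n)
    simp only at hdrop
    rw [hdrop, List.map_cons, List.prod_cons, mul_assoc, ih (k + 1) (by omega) (by omega),
      ← mul_assoc, ← mul_assoc]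
    congr 1
    exact (commute_opTinv (opT_commute t (by right; simp only; omega))).eq.symm

/-- For `ξ_N`, the product of inverses turns `T_i` into `T_{i+1}` and the shift turns it back. The
recursion then descends through `T_k`s that commute with `T_i`. -/
theorem opT_commute_cherednik_of_lt (q : K) {t : K} (ht : t ≠ 0) (i : Fin n) (k : Fin (n + 1))
    (hk : (i : ℕ) + 1 < k) : Commute (opT t i) (cherednik n q t k) := by
  induction k using Fin.reverseInduction with
  | last =>
    rw [Fin.val_last] at hk
    have h := prod_opTinv_commute ht (i := i) (j := ⟨i + 1, hk⟩) rfl 0 (Nat.zero_le _)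
    rw [List.drop_zero] at h
    have hw : opT t i * opW n q = opW n q * opT t ⟨i + 1, hk⟩ :=
      LinearMap.ext fun p => by
        rw [Module.End.mul_apply, Module.End.mul_apply, opW_opT q t (i := i) rfl]
    rw [cherednik_last, opXi]
    apply Commute.smul_right
    rw [Commute, SemiconjBy, ← mul_assoc, hw, mul_assoc, prodTinv, ← h, mul_assoc]
  | cast k ih =>
    rw [cherednik_castSucc q ht]
    rw [Fin.val_castSucc] at hk
    have h1 : Commute (opT t i) (opT (K := K) t k) := opT_commute t (Or.inl hk)
    exact (((h1.mul_right (ih (by rw [Fin.val_succ]; omega))).mul_right h1).smul_right _)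

/-- The critical case is `i = k + 1`. There `ξ_k = t⁻² T_k T_i ξ_{i+1} T_i T_k`; a braid relation
turns `T_i` into `T_k` on its way in, `T_k` passes `ξ_{i+1}`, and a second braid relation restores
`T_i` on the way out. -/
theorem opT_commute_cherednik_of_gt (q : K) {t : K} (ht : t ≠ 0) (i : Fin n) (k : Fin (n + 1))
    (hk : (k : ℕ) < i) : Commute (opT t i) (cherednik n q t k) := by
  induction k using Fin.reverseInduction with
  | last => exact absurd i.isLt (by rw [Fin.val_last] at hk; omega)
  | cast k ih =>
    rw [Fin.val_castSucc] at hk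
    by_cases hki : (k : ℕ) + 1 < i
    · rw [cherednik_castSucc q ht]
      have h1 : Commute (opT t i) (opT (K := K) t k) := opT_commute t (Or.inr hki)
      exact (((h1.mul_right (ih (by rw [Fin.val_succ]; omega))).mul_right h1).smul_right _)
    · have hik : (i : ℕ) = k + 1 := by omega
      have hm : k.succ = i.castSucc := Fin.ext (by simp [hik])
      rw [cherednik_castSucc q ht, hm, cherednik_castSucc q ht]
      simp only [mul_smul_comm, smul_mul_assoc]
      apply Commute.smul_right
      apply Commute.smul_right
      have hb := opT_braid (K := K) t hik
      have hc := opT_commute_cherednik_of_lt q ht k i.succ (by rw [Fin.val_succ]; omega)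
      set Y := cherednik n q t i.succ
      have e : opT t k * (opT t i * Y * opT t i) * opT t k =
          opT t k * opT t i * Y * (opT t i * opT t k) := by simp only [mul_assoc]
      rw [e, Commute, SemiconjBy]
      calc opT t i * (opT t k * opT t i * Y * (opT t i * opT t k))
          = (opT t i * opT t k * opT t i) * Y * (opT t i * opT t k) := by simp only [mul_assoc]
        _ = opT t k * opT t i * (opT t k * Y) * (opT t i * opT t k) := by
            rw [← hb]; simp only [mul_assoc]
        _ = opT t k * opT t i * Y * (opT t k * opT t i * opT t k) := by
            rw [hc.eq]; simp only [mul_assoc]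
        _ = opT t k * opT t i * Y * (opT t i * opT t k) * opT t i := by
            rw [hb]; simp only [mul_assoc]

/-- `f ↦ x_N (f w)`. -/
noncomputable def opPhi (n : ℕ) (q : K) : Module.End K (MvPolynomial (Fin (n + 1)) K) :=
  LinearMap.mulLeft K (X (Fin.last n)) * opW n q

theorem opPhi_apply (q : K) (f : MvPolynomial (Fin (n + 1)) K) :
    opPhi n q f = X (Fin.last n) * opW n q f := rfl

theorem opT_mul_opPhi (q t : K) {i j : Fin n} (h : (j : ℕ) = i + 1) :
    opT t i * opPhi n q = opPhi n q * opT t j := by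
  refine LinearMap.ext fun p => ?_
  simp only [Module.End.mul_apply, opPhi_apply]
  rw [opW_opT q t h, opT_mul_of_invariant]
  rw [rename_X, adj_of_ne] <;>
  simp only [ne_eq, Fin.ext_iff, Fin.val_castSucc, Fin.val_succ, Fin.val_last] <;> omega

theorem opTinv_mul_opPhi (q t : K) {i j : Fin n} (h : (j : ℕ) = i + 1) :
    opTinv t i * opPhi n q = opPhi n q * opTinv t j := by
  simp only [opTinv, smul_mul_assoc, mul_smul_comm, add_mul, mul_add, opT_mul_opPhi q t h, one_mul,
    mul_one]

/-- Each `T_i⁻¹` passing `x_{i+1}` lowers it to `x_i`, becomes `T_i` and leaves a factor `t⁻¹`. -/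
theorem prod_opTinv_X_last_mul {t : K} (ht : t ≠ 0) (k : Fin (n + 1))
    (g : MvPolynomial (Fin (n + 1)) K) :
    t ^ (n - (k : ℕ)) • (((List.finRange n).drop k).map (opTinv t)).prod (X (Fin.last n) * g) =
      X k * (((List.finRange n).drop k).map (opT t)).prod g := by
  induction k using Fin.reverseInduction with
  | last =>
    rw [Fin.val_last, List.drop_eq_nil_of_le (by simp)]
    simp
  | cast i ih =>
    rw [Fin.val_succ] at ih
    have hi := i.isLt
    rw [Fin.val_castSucc, drop_finRange, List.map_cons, List.prod_cons, List.map_cons,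
      List.prod_cons, Module.End.mul_apply, Module.End.mul_apply,
      show n - (i : ℕ) = (n - (i + 1)) + 1 by omega, pow_succ', mul_smul, ← map_smul, ih,
      opTinv_X_succ_mul ht, smul_inv_smul₀ ht]

/-- The inverse operators lower `x_N` to `x_1`, which the shift sends to `q x_N`. This produces the
factor `q` in `ζ_{αΦ}(N) = q ζ_α(1)`. -/
theorem cherednik_last_mul_opPhi (q : K) {t : K} (ht : t ≠ 0) :
    cherednik n q t (Fin.last n) * opPhi n q = q • (opPhi n q * cherednik n q t 0) := by
  refine LinearMap.ext fun p => ?_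
  have h := prod_opTinv_X_last_mul ht 0 (opW n q p)
  rw [Fin.val_zero, List.drop_zero, Nat.sub_zero] at h
  rw [cherednik_last, opXi, cherednik_zero, Module.End.mul_apply, LinearMap.smul_apply,
    LinearMap.smul_apply, Module.End.mul_apply, Module.End.mul_apply, Module.End.mul_apply,
    opPhi_apply, opPhi_apply, ← map_smul, prodTinv, h, opW_mul, opW_X_zero, prodT, smul_mul_assoc]

theorem prod_castSucc_opTinv_mul_opPhi {m : ℕ} (q t : K) (l : List (Fin m)) :
    ((l.map Fin.castSucc).map (opTinv t)).prod * opPhi (m + 1) q =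
      opPhi (m + 1) q * ((l.map Fin.succ).map (opTinv t)).prod := by
  induction l with
  | nil => simp
  | cons a l ih =>
    simp only [List.map_cons, List.prod_cons]
    rw [mul_assoc, ih, ← mul_assoc, opTinv_mul_opPhi q t (j := a.succ) (by simp), mul_assoc]

/-- Only `ξ_{N-1}` needs work: there `ξ_N` is expanded and `T_{N-1}` meets two shifts. Below it the
recursion and `opT_mul_opPhi` carry the relation down. -/
theorem cherednik_castSucc_mul_opPhi (q : K) {t : K} (ht : t ≠ 0) (i : Fin n) :
    cherednik n q t i.castSucc * opPhi n q = opPhi n q * cherednik n q t i.succ := by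
  obtain ⟨m, rfl⟩ : ∃ m, n = m + 1 := ⟨n - 1, by have := i.isLt; omega⟩
  induction i using Fin.reverseInduction with
  | last =>
    have e1 : prodTinv (m + 1) t =
        (((List.finRange m).map Fin.castSucc).map (opTinv t)).prod * opTinv (K := K) t
          (Fin.last m) := by
      rw [prodTinv, List.finRange_succ_last, List.map_append, List.prod_append,
        List.map_singleton, List.prod_singleton]
    have e2 : prodTinv (m + 1) t =
        opTinv (K := K) t 0 * (((List.finRange m).map Fin.succ).map (opTinv t)).prod := by
      rw [prodTinv, List.finRange_succ, List.map_cons, List.prod_cons]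
    rw [cherednik_castSucc q ht, Fin.succ_last, cherednik_last, opXi]
    set P := (((List.finRange m).map Fin.succ).map (opTinv (K := K) t)).prod with hP
    have hA : prodTinv (m + 1) t * opT t (Fin.last m) * opPhi (m + 1) q =
        opPhi (m + 1) q * P := by
      rw [e1, mul_assoc _ (opTinv t (Fin.last m)), opTinv_mul_opT ht, mul_one,
        prod_castSucc_opTinv_mul_opPhi]
    have hW : opT t (Fin.last m) * opW (m + 1) q * opPhi (m + 1) q =
        t • (opPhi (m + 1) q * opW (m + 1) q * opTinv t 0) := by
      refine LinearMap.ext fun p => ?_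
      simp only [Module.End.mul_apply, LinearMap.smul_apply, opPhi_apply]
      -- With `p = T_1 r`, the double shift turns `T_1` into `T_{N-1}`, and `T_{N-1} x_{N-1} T_{N-1}
      -- = t x_N` finishes.
      obtain ⟨r, rfl⟩ : ∃ r, p = opT t 0 r := ⟨opTinv t 0 p, (opT_opTinv_apply ht 0 p).symm⟩
      rw [opTinv_opT_apply ht, opW_mul, ← Fin.succ_last, opW_X_succ, opW_opW_opT,
        opT_X_mul_opT]
    calc t⁻¹ • (opT t (Fin.last m) * t ^ (m + 1) • (opW (m + 1) q * prodTinv (m + 1) t) *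
          opT t (Fin.last m)) * opPhi (m + 1) q
        = (t⁻¹ * t ^ (m + 1)) • (opT t (Fin.last m) * opW (m + 1) q *
            (prodTinv (m + 1) t * opT t (Fin.last m) * opPhi (m + 1) q)) := by
          simp only [mul_smul_comm, smul_mul_assoc, smul_smul, mul_assoc]
      _ = (t⁻¹ * t ^ (m + 1)) • ((opT t (Fin.last m) * opW (m + 1) q * opPhi (m + 1) q) * P) := by
          rw [hA]; simp only [mul_assoc]
      _ = (t⁻¹ * t ^ (m + 1) * t) •
            (opPhi (m + 1) q * opW (m + 1) q * (opTinv t 0 * P)) := by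
          rw [hW]; simp only [smul_mul_assoc, smul_smul, mul_assoc]
      _ = opPhi (m + 1) q * t ^ (m + 1) • (opW (m + 1) q * prodTinv (m + 1) t) := by
          rw [e2, mul_smul_comm, mul_right_comm, inv_mul_cancel₀ ht, one_mul, mul_assoc]
  | cast i ih =>
    have h : ((i.succ : Fin (m + 1)) : ℕ) = (i.castSucc : Fin (m + 1)) + 1 := by simp
    have hm : (i.succ : Fin (m + 1)).castSucc = (i.castSucc : Fin (m + 1)).succ := by
      rw [Fin.castSucc_succ]
    have hT := opT_mul_opPhi q t h
    have e := cherednik_castSucc q ht i.castSucc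
    have e' := cherednik_castSucc q ht i.succ
    rw [← hm] at e ⊢
    rw [e]
    set Y := cherednik (m + 1) q t i.succ.castSucc
    calc t⁻¹ • (opT t i.castSucc * Y * opT t i.castSucc) * opPhi (m + 1) q
        = t⁻¹ • (opT t i.castSucc * (Y * (opT t i.castSucc * opPhi (m + 1) q))) := by
          simp only [smul_mul_assoc, mul_assoc]
      _ = t⁻¹ • (opT t i.castSucc * (Y * opPhi (m + 1) q * opT t i.succ)) := by
          rw [hT, mul_assoc]
      _ = t⁻¹ • (opT t i.castSucc * opPhi (m + 1) q *
            (cherednik (m + 1) q t i.succ.succ * opT t i.succ)) := by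
          rw [ih]; simp only [mul_assoc]
      _ = opPhi (m + 1) q * Y := by
          rw [hT, e']; simp only [mul_smul_comm, mul_assoc]

end Cherednik

/-! ### Ranks and spectral vectors -/

section Rank

variable {n : ℕ}

theorem rank_eq_sum (α : Fin (n + 1) → ℕ) (i : Fin (n + 1)) :
    rank α i = ∑ j, ((if α i < α j then 1 else 0) + if j ≤ i ∧ α j = α i then 1 else 0) := by
  rw [rank, Finset.card_filter, Finset.card_filter, Finset.sum_add_distrib]

theorem one_le_rank (α : Fin (n + 1) → ℕ) (i : Fin (n + 1)) : 1 ≤ rank α i := by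
  have : 0 < (Finset.univ.filter fun j => j ≤ i ∧ α j = α i).card :=
    Finset.card_pos.mpr ⟨i, by simp⟩
  rw [rank]
  omega

theorem rank_le (α : Fin (n + 1) → ℕ) (i : Fin (n + 1)) : rank α i ≤ n + 1 := by
  rw [rank_eq_sum]
  calc _ ≤ ∑ _j : Fin (n + 1), 1 := by
        refine Finset.sum_le_sum fun j _ => ?_
        split_ifs <;> omega
    _ = n + 1 := by simp

/-- The rank numbers positions by decreasing entry, ties from left to right. -/
theorem rank_lt_of_lt {α : Fin (n + 1) → ℕ} {i j : Fin (n + 1)}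
    (h : α j < α i ∨ α i = α j ∧ i < j) : rank α i < rank α j := by
  rw [rank_eq_sum, rank_eq_sum]
  refine Finset.sum_lt_sum (fun k _ => ?_) ⟨j, Finset.mem_univ j, ?_⟩
  · split_ifs <;> omega
  · split_ifs <;> omega

theorem rank_lt_iff {α : Fin (n + 1) → ℕ} {i j : Fin (n + 1)} :
    rank α i < rank α j ↔ α j < α i ∨ α i = α j ∧ i < j := by
  refine ⟨fun h => ?_, rank_lt_of_lt⟩
  by_contra hc
  by_cases hij : i = j
  · subst hij; omega
  · have := rank_lt_of_lt (α := α) (i := j) (j := i) (by omega)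
    omega

theorem rank_injective (α : Fin (n + 1) → ℕ) : Function.Injective (rank α) := by
  intro i j h
  have h1 := rank_lt_iff (α := α) (i := i) (j := j)
  have h2 := rank_lt_iff (α := α) (i := j) (j := i)
  omega

theorem image_rank (α : Fin (n + 1) → ℕ) :
    Finset.univ.image (rank α) = Finset.Icc 1 (n + 1) := by
  apply Finset.eq_of_subset_of_card_le
  · intro r hr
    obtain ⟨i, -, rfl⟩ := Finset.mem_image.mp hr
    exact Finset.mem_Icc.mpr ⟨one_le_rank α i, rank_le α i⟩
  · rw [Finset.card_image_of_injective _ (rank_injective α)]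
    simp

/-- Ranks travel with their entries: `s_i` reverses only the order of positions `i, i + 1`, and
their entries differ, so no tie is affected. -/
theorem rank_comp_adj {α : Fin (n + 1) → ℕ} {i : Fin n} (h : α i.castSucc ≠ α i.succ)
    (k : Fin (n + 1)) : rank (α ∘ adj i) k = rank α (adj i k) := by
  rw [rank_eq_sum, rank_eq_sum, ← Equiv.sum_comp (adj i)]
  refine Finset.sum_congr rfl fun j _ => ?_
  simp only [Function.comp_apply, adj_adj]
  have : (adj i j ≤ k ∧ α j = α (adj i k)) ↔ (j ≤ adj i k ∧ α j = α (adj i k)) := by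
    refine and_congr_left fun he => ?_
    by_cases k1 : k = i.castSucc
    · subst k1
      rw [adj_castSucc] at he ⊢
      by_cases j1 : j = i.castSucc
      · subst j1; exact absurd he h
      by_cases j2 : j = i.succ
      · subst j2; simp [adj_succ]
      rw [adj_of_ne j1 j2]
      simp only [Fin.ext_iff, Fin.le_def, Fin.val_castSucc, Fin.val_succ] at *
      omega
    by_cases k2 : k = i.succ
    · subst k2
      rw [adj_succ] at he ⊢
      by_cases j2 : j = i.succ
      · subst j2; exact absurd he.symm h
      by_cases j1 : j = i.castSucc
      · subst j1; simp [adj_castSucc]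
      rw [adj_of_ne j1 j2]
      simp only [Fin.ext_iff, Fin.le_def, Fin.val_castSucc, Fin.val_succ] at *
      omega
    rw [adj_of_ne k1 k2]
    by_cases j1 : j = i.castSucc
    · subst j1
      rw [adj_castSucc]
      simp only [Fin.ext_iff, Fin.le_def, Fin.val_castSucc, Fin.val_succ] at *
      omega
    by_cases j2 : j = i.succ
    · subst j2
      rw [adj_succ]
      simp only [Fin.ext_iff, Fin.le_def, Fin.val_castSucc, Fin.val_succ] at *
      omega
    rw [adj_of_ne j1 j2]
  rw [if_congr this rfl rfl]

/-- The label `αΦ = (α_2, …, α_N, α_1 + 1)`. -/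
def affineLabel (α : Fin (n + 1) → ℕ) : Fin (n + 1) → ℕ := Fin.snoc (Fin.tail α) (α 0 + 1)

theorem affineLabel_castSucc (α : Fin (n + 1) → ℕ) (i : Fin n) :
    affineLabel α i.castSucc = α i.succ := by
  simp [affineLabel, Fin.tail]

theorem affineLabel_last (α : Fin (n + 1) → ℕ) : affineLabel α (Fin.last n) = α 0 + 1 := by
  simp [affineLabel]

/-- Entries exceeding `α_1` are those at least `α_1 + 1`; a tie with the raised entry, now last, is
lost by that entry. So the ordering by rank survives `Φ`. -/
theorem rank_affineLabel_castSucc (α : Fin (n + 1) → ℕ) (i : Fin n) :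
    rank (affineLabel α) i.castSucc = rank α i.succ := by
  rw [rank_eq_sum, rank_eq_sum, Fin.sum_univ_castSucc, Fin.sum_univ_succ, add_comm]
  simp only [affineLabel_castSucc, affineLabel_last, Fin.castSucc_le_castSucc_iff,
    Fin.succ_le_succ_iff]
  congr 1
  have h1 : ¬ Fin.last n ≤ i.castSucc := not_le.mpr (Fin.castSucc_lt_last i)
  have h2 : (0 : Fin (n + 1)) ≤ i.succ := Fin.zero_le _
  simp only [h1, h2, false_and, true_and, if_false]
  split_ifs <;> omega

theorem rank_affineLabel_last (α : Fin (n + 1) → ℕ) :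
    rank (affineLabel α) (Fin.last n) = rank α 0 := by
  rw [rank_eq_sum, rank_eq_sum, Fin.sum_univ_castSucc, Fin.sum_univ_succ, add_comm]
  simp only [affineLabel_castSucc, affineLabel_last, Fin.le_last, lt_irrefl, true_and,
    if_true, le_refl]
  congr 1
  refine Finset.sum_congr rfl fun j _ => ?_
  have h2 : ¬ j.succ ≤ 0 := not_le.mpr (Fin.succ_pos j)
  simp only [h2, false_and, if_false]
  split_ifs <;> omega

theorem rank_of_antitone {lam : Fin (n + 1) → ℕ} (h : Antitone lam) (i : Fin (n + 1)) :
    rank lam i = i + 1 := by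
  have : ∀ j, ((if lam i < lam j then 1 else 0) + if j ≤ i ∧ lam j = lam i then 1 else 0) =
      if j ≤ i then 1 else 0 := by
    intro j
    have h1 : j ≤ i → lam i ≤ lam j := fun hji => h hji
    have h2 : i ≤ j → lam j ≤ lam i := fun hij => h hij
    split_ifs <;> omega
  rw [rank_eq_sum, Finset.sum_congr rfl fun j _ => this j, ← Finset.card_filter]
  rw [show (Finset.univ.filter fun j => j ≤ i) = Finset.Iic i by ext; simp, Fin.card_Iic]

variable {K : Type*} [Field K] {q t : K}

theorem IsGeneric.ne_one {N : ℕ} (h : IsGeneric N q t) {a b : ℤ} (ha : a ≠ 0) (hb : |b| ≤ N) :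
    q ^ a * t ^ b ≠ 1 :=
  h.2.2 a b (abs_le.mp hb).1 (abs_le.mp hb).2 (by simp [ha])

theorem IsGeneric.q_ne_one {N : ℕ} (h : IsGeneric N q t) : q ≠ 1 := by
  simpa using h.ne_one one_ne_zero (b := 0) (by simp)

theorem zeta_comp_adj {α : Fin (n + 1) → ℕ} {i : Fin n} (h : α i.castSucc ≠ α i.succ)
    (k : Fin (n + 1)) : zeta q t (α ∘ adj i) k = zeta q t α (adj i k) := by
  rw [zeta, zeta, rank_comp_adj h, Function.comp_apply]

theorem zeta_affineLabel_castSucc (α : Fin (n + 1) → ℕ) (i : Fin n) :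
    zeta q t (affineLabel α) i.castSucc = zeta q t α i.succ := by
  rw [zeta, zeta, rank_affineLabel_castSucc, affineLabel_castSucc]

theorem zeta_affineLabel_last (α : Fin (n + 1) → ℕ) :
    zeta q t (affineLabel α) (Fin.last n) = q * zeta q t α 0 := by
  rw [zeta, zeta, rank_affineLabel_last, affineLabel_last, pow_succ', mul_assoc]

theorem zeta_ne_zero (hq : q ≠ 0) (ht : t ≠ 0) (α : Fin (n + 1) → ℕ) (i : Fin (n + 1)) :
    zeta q t α i ≠ 0 :=
  mul_ne_zero (pow_ne_zero _ hq) (zpow_ne_zero _ ht)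

theorem zeta_div (hq : q ≠ 0) (ht : t ≠ 0) (α : Fin (n + 1) → ℕ) (i j : Fin (n + 1)) :
    zeta q t α j / zeta q t α i =
      q ^ ((α j : ℤ) - α i) * t ^ ((rank α i : ℤ) - rank α j) := by
  rw [zeta, zeta, mul_div_mul_comm, ← zpow_sub₀ ht, zpow_sub₀ hq, zpow_natCast, zpow_natCast]
  congr 2
  ring

theorem IsGeneric.zeta_div_ne_one (h : IsGeneric (n + 1) q t) {α : Fin (n + 1) → ℕ}
    {i j : Fin (n + 1)} (hij : α i ≠ α j) : zeta q t α j / zeta q t α i ≠ 1 := by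
  rw [zeta_div h.1 h.2.1]
  apply h.ne_one (by omega)
  have := one_le_rank α i
  have := one_le_rank α j
  have := rank_le α i
  have := rank_le α j
  rw [abs_le]
  omega

end Rank

/-! ### Eigenvectors and norm recursions -/

section Eigen

variable {K : Type*} [Field K] {n : ℕ} {q t : K}

theorem opT_one (i : Fin n) : opT t i (1 : MvPolynomial (Fin (n + 1)) K) = t • 1 := by
  have h : divDiff i (1 : MvPolynomial (Fin (n + 1)) K) = 0 := divDiff_unique i (by simp)
  rw [opT_apply, h, map_one, smul_eq_C_mul]
  ring

theorem opTinv_one (ht : t ≠ 0) (i : Fin n) :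
    opTinv t i (1 : MvPolynomial (Fin (n + 1)) K) = t⁻¹ • 1 := by
  rw [eq_inv_smul_iff₀ ht, ← map_smul, ← opT_one i, opTinv_opT_apply ht]

theorem prod_opTinv_one (ht : t ≠ 0) (l : List (Fin n)) :
    (l.map (opTinv t)).prod (1 : MvPolynomial (Fin (n + 1)) K) = (t⁻¹) ^ l.length • 1 := by
  induction l with
  | nil => simp
  | cons a l ih =>
    rw [List.map_cons, List.prod_cons, Module.End.mul_apply, ih, map_smul, opTinv_one ht, smul_smul,
      List.length_cons, pow_succ]

theorem cherednik_one (ht : t ≠ 0) (k : Fin (n + 1)) :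
    cherednik n q t k 1 = zeta q t 0 k • 1 := by
  have hz : zeta q t (0 : Fin (n + 1) → ℕ) k = t ^ (n - (k : ℕ)) := by
    have := k.isLt
    rw [zeta, rank_of_antitone (fun _ _ _ => le_rfl), Pi.zero_apply, pow_zero, one_mul,
      ← zpow_natCast]
    congr 1
    omega
  rw [hz]
  clear hz
  induction k using Fin.reverseInduction with
  | last =>
    rw [cherednik_last, opXi, prodTinv, LinearMap.smul_apply, Module.End.mul_apply,
      prod_opTinv_one ht, map_smul, opW_eq, map_one, smul_smul, List.length_finRange, inv_pow,
      mul_inv_cancel₀ (pow_ne_zero _ ht), Fin.val_last, Nat.sub_self, pow_zero]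
  | cast i ih =>
    have := i.isLt
    rw [cherednik_castSucc q ht, LinearMap.smul_apply, Module.End.mul_apply, Module.End.mul_apply,
      opT_one, map_smul, ih, map_smul, map_smul, opT_one, inv_smul_smul₀ ht, smul_smul,
      ← pow_succ, Fin.val_succ, Fin.val_castSucc]
    congr 2
    omega

/-- The span of `p` and `T_i p` is stable under `ξ_i` and `ξ_{i+1}`, by `T_i ξ_{i+1} T_i = t ξ_i`
and the quadratic relation. Since `T_i p` is sent by `ξ_{i+1}` to `a T_i p + (1 - t) a p`, the
coefficient `c` of `p` must satisfy `(1 - t) a = c (a - b)`. -/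
theorem cherednik_opT_step (ht : t ≠ 0) {i : Fin n}
    {p : MvPolynomial (Fin (n + 1)) K} {a b : K} (ha : a ≠ 0) (hab : b / a ≠ 1)
    (h1 : cherednik n q t i.castSucc p = a • p) (h2 : cherednik n q t i.succ p = b • p) :
    cherednik n q t i.castSucc (opT t i p + ((1 - t) / (1 - b / a)) • p) =
        b • (opT t i p + ((1 - t) / (1 - b / a)) • p) ∧
      cherednik n q t i.succ (opT t i p + ((1 - t) / (1 - b / a)) • p) =
        a • (opT t i p + ((1 - t) / (1 - b / a)) • p) := by
  have hc : ∀ f, opT t i (cherednik n q t i.succ (opT t i f)) =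
      t • cherednik n q t i.castSucc f := by
    intro f
    rw [cherednik_castSucc q ht, LinearMap.smul_apply, smul_inv_smul₀ ht]
    rfl
  have hs : cherednik n q t i.succ (opT t i p) = a • opT t i p + ((1 - t) * a) • p := by
    have h := congrArg (opTinv t i) (hc p)
    rw [opTinv_opT_apply ht, h1, map_smul, map_smul, smul_comm] at h
    rw [h, opTinv, LinearMap.smul_apply, smul_inv_smul₀ ht]
    simp only [LinearMap.add_apply, LinearMap.smul_apply, Module.End.one_apply]
    module
  have hcs : cherednik n q t i.castSucc (opT t i p) = b • opT t i p + ((t - 1) * a) • p := by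
    have h := hc (opT t i p)
    rw [opT_opT_apply, map_add, map_smul, map_smul, h2, map_add, map_smul, hc p, h1, map_smul,
      map_smul] at h
    rw [← inv_smul_eq_iff₀ ht] at h
    rw [← h]
    rw [smul_comm _ t, ← smul_add, inv_smul_smul₀ ht]
    module
  have hne : 1 - b / a ≠ 0 := sub_ne_zero.mpr hab.symm
  have key : (1 - t) * a = (1 - t) / (1 - b / a) * (a - b) := by
    have : a - b ≠ 0 := fun h => hab (by rw [← sub_eq_zero.mp h, div_self ha])
    field_simp
  refine ⟨?_, ?_⟩
  · rw [map_add, map_smul, h1, hcs]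
    have : (t - 1) * a = -((1 - t) / (1 - b / a) * (a - b)) := by rw [← key]; ring
    rw [this]
    module
  · rw [map_add, map_smul, h2, hs, key]
    module

/-- The nonsymmetric Macdonald polynomials are simultaneous eigenvectors of the Cherednik
operators. -/
theorem IsMacdonald.cherednik_apply (hqt : IsGeneric (n + 1) q t) {α : Fin (n + 1) → ℕ}
    {p : MvPolynomial (Fin (n + 1)) K} (hp : IsMacdonald q t α p) (k : Fin (n + 1)) :
    cherednik n q t k p = zeta q t α k • p := by
  have hq := hqt.1
  have ht := hqt.2.1
  induction hp generalizing k with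
  | root => exact cherednik_one ht k
  | @step α p i hi hp ih =>
    obtain ⟨e1, e2⟩ := cherednik_opT_step ht (zeta_ne_zero hq ht α i.castSucc)
      (hqt.zeta_div_ne_one hi.ne) (ih i.castSucc) (ih i.succ)
    rw [zeta_comp_adj hi.ne]
    by_cases h1 : k = i.castSucc
    · rw [h1, adj_castSucc, e1]
    by_cases h2 : k = i.succ
    · rw [h2, adj_succ, e2]
    rw [adj_of_ne h1 h2]
    have hc : Commute (opT t i) (cherednik n q t k) := by
      rw [Fin.ext_iff, Fin.val_castSucc] at h1
      rw [Fin.ext_iff, Fin.val_succ] at h2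
      rcases Nat.lt_or_ge k i with h | h
      · exact opT_commute_cherednik_of_gt q ht i k h
      · exact opT_commute_cherednik_of_lt q ht i k (by omega)
    rw [map_add, map_smul, ← Module.End.mul_apply, ← hc.eq, Module.End.mul_apply, ih, map_smul,
      smul_add, smul_comm (zeta q t α k) (_ / _)]
  | @affine α p hp ih =>
    change cherednik n q t k (opPhi n q p) = zeta q t (affineLabel α) k • opPhi n q p
    induction k using Fin.lastCases with
    | last =>
      rw [← Module.End.mul_apply, cherednik_last_mul_opPhi q ht, LinearMap.smul_apply,
        Module.End.mul_apply, ih, map_smul, smul_smul, zeta_affineLabel_last]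
    | cast k =>
      rw [← Module.End.mul_apply, cherednik_castSucc_mul_opPhi q ht, Module.End.mul_apply, ih,
        map_smul, zeta_affineLabel_castSucc]

/-! ### Adjoints and norm recursions under (BF1). -/

variable {B : LinearMap.BilinForm K (MvPolynomial (Fin (n + 1)) K)}

theorem BF1.opTinv_adjoint (hB : BF1 q t B) (i : Fin n) (f g : MvPolynomial (Fin (n + 1)) K) :
    B (opTinv t i f) g = B f (opTinv t i g) := by
  simp only [opTinv, LinearMap.smul_apply, LinearMap.add_apply, map_smul, map_add,
    Module.End.one_apply, hB.opT_adjoint]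

theorem BF1.cherednik_adjoint (hB : BF1 q t B) (ht : t ≠ 0) (k : Fin (n + 1))
    (f g : MvPolynomial (Fin (n + 1)) K) :
    B (cherednik n q t k f) g = B f (cherednik n q t k g) := by
  induction k using Fin.reverseInduction generalizing f g with
  | last => rw [cherednik_last, hB.opXi_adjoint]
  | cast i ih =>
    simp only [cherednik_castSucc q ht, LinearMap.smul_apply, map_smul, Module.End.mul_apply,
      hB.opT_adjoint, ih]

theorem BF1.prod_adjoint {A : Fin n → Module.End K (MvPolynomial (Fin (n + 1)) K)}
    (hA : ∀ i f g, B (A i f) g = B f (A i g)) (l : List (Fin n))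
    (f g : MvPolynomial (Fin (n + 1)) K) :
    B ((l.map A).prod f) g = B f ((l.reverse.map A).prod g) := by
  induction l generalizing f g with
  | nil => simp
  | cons a l ih =>
    simp only [List.map_cons, List.prod_cons, Module.End.mul_apply, List.reverse_cons,
      List.map_append, List.prod_append, List.map_nil, List.prod_nil, mul_one, hA, ih]

/-- `w^*` is the adjoint of `w`. -/
theorem BF1.opW_adjoint (hB : BF1 q t B) (ht : t ≠ 0) (f g : MvPolynomial (Fin (n + 1)) K) :
    B (opW n q f) g = B f (opWstar n q t g) := by
  have h1 : ∀ l : List (Fin n),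
      (l.reverse.map (opTinv t)).prod * (l.map (opT (K := K) t)).prod = 1 := by
    intro l
    induction l with
    | nil => simp
    | cons a l ih =>
      rw [List.reverse_cons, List.map_append, List.prod_append, List.map_singleton,
        List.prod_singleton, List.map_cons, List.prod_cons, mul_assoc, ← mul_assoc (opTinv t a),
        opTinv_mul_opT ht, one_mul, ih]
  -- This writes `w` as a product of selfadjoint operators; reversing their order gives `w^*`.
  have h2 : opW n q f =
      ((List.finRange n).reverse.map (opTinv t)).prod (cherednik n q t 0 f) := by
    rw [cherednik_zero, prodT, ← Module.End.mul_apply, ← mul_assoc, h1, one_mul]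
  rw [h2, BF1.prod_adjoint hB.opTinv_adjoint, List.reverse_reverse, hB.cherednik_adjoint ht,
    opWstar_eq, prodTinv, Module.End.mul_apply]

theorem exists_prodTinv_eq (ht : t ≠ 0) (p : MvPolynomial (Fin (n + 1)) K) :
    ∃ g, prodTinv n t g = p := by
  have h : ∀ l : List (Fin n), ∃ g, (l.map (opTinv t)).prod g = p := by
    intro l
    induction l using List.reverseRecOn with
    | nil => exact ⟨p, rfl⟩
    | append_singleton l a ih =>
      obtain ⟨g, hg⟩ := ih
      refine ⟨opT t a g, ?_⟩
      rw [List.map_append, List.prod_append, List.map_singleton, List.prod_singleton,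
        Module.End.mul_apply, opTinv_opT_apply ht, hg]
  exact h _

/-- The factor by which the squared norm changes along a step of the Yang–Baxter graph. -/
noncomputable def stepFactor (t z : K) : K := (t - z) * (1 - t * z) / (1 - z) ^ 2

/-- Selfadjointness of `ξ_i` makes `M_α` orthogonal to its neighbour, so with `c` the coefficient of
`p`, `⟨p, T_i p⟩ = -c ⟨p, p⟩`. The new squared norm is then `(t + (1 - t) c - c²) ⟨p, p⟩`. -/
theorem BF1.step_norm (hqt : IsGeneric (n + 1) q t) (hB : BF1 q t B) {α : Fin (n + 1) → ℕ}
    {p : MvPolynomial (Fin (n + 1)) K} (hp : IsMacdonald q t α p) {i : Fin n}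
    (hi : α i.castSucc < α i.succ) :
    B (opT t i p + ((1 - t) / (1 - zeta q t α i.succ / zeta q t α i.castSucc)) • p)
        (opT t i p + ((1 - t) / (1 - zeta q t α i.succ / zeta q t α i.castSucc)) • p) =
      stepFactor t (zeta q t α i.succ / zeta q t α i.castSucc) * B p p := by
  have hz := hqt.zeta_div_ne_one hi.ne
  have hz' := hqt.zeta_div_ne_one hi.ne'
  obtain ⟨e1, -⟩ := cherednik_opT_step hqt.2.1 (zeta_ne_zero hqt.1 hqt.2.1 α i.castSucc)
      hz (hp.cherednik_apply hqt i.castSucc) (hp.cherednik_apply hqt i.succ)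
  have hort := hB.cherednik_adjoint hqt.2.1 i.castSucc p (opT t i p +
    ((1 - t) / (1 - zeta q t α i.succ / zeta q t α i.castSucc)) • p)
  rw [e1, hp.cherednik_apply hqt, map_smul, LinearMap.smul_apply, smul_eq_mul, map_smul,
    smul_eq_mul] at hort
  have hne : zeta q t α i.castSucc ≠ zeta q t α i.succ := by
    intro h
    rw [h, div_self (zeta_ne_zero hqt.1 hqt.2.1 α _)] at hz
    exact hz rfl
  have h0 := (mul_eq_zero.mp ((sub_mul _ _ _).trans (sub_eq_zero.mpr hort))).resolve_left
    (sub_ne_zero.mpr hne)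
  generalize hzz : zeta q t α i.succ / zeta q t α i.castSucc = z at *
  have hz1 : 1 - z ≠ 0 := sub_ne_zero.mpr hz.symm
  rw [map_add, map_smul, smul_eq_mul] at h0
  have hTT : B (opT t i p) (opT t i p) = (t - 1) * B p (opT t i p) + t * B p p := by
    rw [hB.opT_adjoint, opT_opT_apply, map_add, map_smul, map_smul, smul_eq_mul, smul_eq_mul]
  simp only [map_add, map_smul, LinearMap.add_apply, LinearMap.smul_apply, smul_eq_mul, hTT,
    hB.opT_adjoint i p p]
  rw [eq_neg_of_add_eq_zero_left h0, stepFactor]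
  field_simp
  ring

/-- `D_N` sends `x_N (p w)` to a multiple of `p w`, because the former is a `ξ_N`-eigenvector.
Pairing with a `g` such that `g w^* = p` makes both sides of the `D_N` condition squared norms. -/
theorem BF1.affine_norm (hqt : IsGeneric (n + 1) q t) (hB : BF1 q t B) {α : Fin (n + 1) → ℕ}
    {p : MvPolynomial (Fin (n + 1)) K} (hp : IsMacdonald q t α p) :
    (1 - q) * B (X (Fin.last n) * opW n q p) (X (Fin.last n) * opW n q p) =
      (1 - q * zeta q t α 0) * B p p := by
  have ht := hqt.2.1
  -- `w^*` is the product of inverses followed by `ξ_1`, and `ξ_1` scales `p` by `ζ_α(1)`.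
  obtain ⟨g, hg⟩ := exists_prodTinv_eq ht ((zeta q t α 0)⁻¹ • p)
  have hgs : opWstar n q t g = p := by
    rw [opWstar_eq, Module.End.mul_apply, hg, map_smul, hp.cherednik_apply hqt,
      inv_smul_smul₀ (zeta_ne_zero hqt.1 ht α 0)]
  have hx : opXi n q t (X (Fin.last n) * opW n q p) =
      (q * zeta q t α 0) • (X (Fin.last n) * opW n q p) := by
    rw [← zeta_affineLabel_last, ← cherednik_last]
    exact hp.affine.cherednik_apply hqt (Fin.last n)
  have hd : opD n q t (X (Fin.last n) * opW n q p) = (1 - q * zeta q t α 0) • opW n q p := by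
    apply mul_left_cancel₀ (X_ne_zero (R := K) (Fin.last n))
    rw [X_mul_opD n q ht, hx, mul_smul_comm, sub_smul, one_smul]
  have h := hB.opD_adjoint (X (Fin.last n) * opW n q p) g
  rw [hgs, hd, map_smul, LinearMap.smul_apply, smul_eq_mul, hB.opW_adjoint ht, hgs] at h
  exact h.symm

end Eigen

/-! ### The norm formula for compositions -/

section Combinatorics

variable {K : Type*} [Field K] {n : ℕ}

/-- The number of boxes in column `j` (numbered from `0`) of the diagram of `α`. -/
def colCard (α : Fin (n + 1) → ℕ) (j : ℕ) : ℕ := (Finset.univ.filter fun k => j + 1 ≤ α k).card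

theorem colCard_eq_sum (α : Fin (n + 1) → ℕ) (j : ℕ) :
    colCard α j = ∑ k, if j + 1 ≤ α k then 1 else 0 := by
  rw [colCard, Finset.card_filter]

theorem colCard_le (α : Fin (n + 1) → ℕ) (j : ℕ) : colCard α j ≤ n + 1 :=
  (Finset.card_le_univ _).trans (by simp)

/-- Entries exceeding `j` have the smallest ranks, so column `j` fills exactly the ranks up to its
height. Column conditions thus become intervals of ranks. -/
theorem rank_le_colCard_iff {α : Fin (n + 1) → ℕ} {j : ℕ} {k : Fin (n + 1)} :
    rank α k ≤ colCard α j ↔ j < α k := by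
  rw [rank_eq_sum, colCard_eq_sum]
  constructor
  · intro h
    by_contra hc
    refine absurd h (not_le.mpr (Finset.sum_lt_sum (fun l _ => ?_) ⟨k, Finset.mem_univ k, ?_⟩))
    · split_ifs <;> omega
    · simp; omega
  · intro h
    refine Finset.sum_le_sum fun l _ => ?_
    split_ifs <;> omega

theorem rank_zero_eq (α : Fin (n + 1) → ℕ) : rank α 0 = colCard α (α 0) + 1 := by
  have : (Finset.univ.filter fun j : Fin (n + 1) => j ≤ 0 ∧ α j = α 0) = {0} := by
    ext j
    simp only [Finset.mem_filter, Finset.mem_univ, true_and, Finset.mem_singleton,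
      Fin.le_zero_iff]
    exact ⟨fun h => h.1, fun h => ⟨h, h ▸ rfl⟩⟩
  rw [rank, this, colCard, Finset.card_singleton]
  rfl

theorem colCard_comp_adj (α : Fin (n + 1) → ℕ) (i : Fin n) (j : ℕ) :
    colCard (α ∘ adj i) j = colCard α j := by
  rw [colCard_eq_sum, colCard_eq_sum, ← Equiv.sum_comp (adj i)]
  simp only [Function.comp_apply, adj_adj]

theorem colCard_affineLabel (α : Fin (n + 1) → ℕ) (j : ℕ) :
    colCard (affineLabel α) j = colCard α j + if j = α 0 then 1 else 0 := by
  rw [colCard_eq_sum, colCard_eq_sum, Fin.sum_univ_castSucc, Fin.sum_univ_succ]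
  simp only [affineLabel_castSucc, affineLabel_last]
  rw [add_comm, add_right_comm]
  congr 1
  split_ifs <;> omega

/-! ### Telescoping products over the boxes of a diagram. -/

theorem prod_range_div_succ {h : ℕ → K} {m : ℕ} (hm : ∀ i ≤ m, h i ≠ 0) :
    ∏ i ∈ Finset.range m, h i / h (i + 1) = h 0 / h m := by
  induction m with
  | zero => simp [hm 0 le_rfl]
  | succ m ih =>
    rw [Finset.prod_range_succ, ih fun i hi => hm i (by omega),
      div_mul_div_cancel₀ (hm m (by omega))]

/-- A product over ranks is a product over positions. -/
theorem prod_rank_eq_prod_range (α : Fin (n + 1) → ℕ) {r m : ℕ} (hm : m ≤ n + 1)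
    (g : ℕ → K) :
    ∏ k, (if r < rank α k ∧ rank α k ≤ m then g (rank α k - r - 1) else 1) =
      ∏ s ∈ Finset.range (m - r), g s := by
  have h := Finset.prod_image (s := Finset.univ) (g := rank α)
    (f := fun s => if r < s ∧ s ≤ m then g (s - r - 1) else 1)
    (fun i _ j _ hij => rank_injective α hij)
  rw [image_rank] at h
  rw [← h, ← Finset.prod_filter]
  refine Finset.prod_nbij' (fun s => s - r - 1) (fun s => s + r + 1) ?_ ?_ ?_ ?_ ?_ <;>
    intro s hs <;> simp only [Finset.mem_filter, Finset.mem_Icc, Finset.mem_range] at hs ⊢ <;>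
    omega

/-- The product over the boxes of the diagram of `α` of a function of arm and leg. -/
def boxProd (f : ℕ → ℕ → K) (α : Fin (n + 1) → ℕ) : K :=
  ∏ i, ∏ j ∈ Finset.range (α i), f (α i - (j + 1)) (colCard α j - rank α i)

theorem boxProd_comp_adj (f : ℕ → ℕ → K) {α : Fin (n + 1) → ℕ} {i : Fin n}
    (h : α i.castSucc ≠ α i.succ) : boxProd f (α ∘ adj i) = boxProd f α := by
  rw [boxProd, boxProd, ← Equiv.prod_comp (adj i)]
  simp only [rank_comp_adj h, colCard_comp_adj, Function.comp_apply, adj_adj]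

theorem eq_mul_prod_div {f : ℕ → K} {m : ℕ} (hf : ∀ s ≤ m, f s ≠ 0) :
    f m = f 0 * ∏ s ∈ Finset.range m, f (s + 1) / f s := by
  have h := prod_range_div_succ (h := fun s => (f s)⁻¹) (fun s hs => inv_ne_zero (hf s hs))
  simp only [inv_div_inv] at h
  rw [h, mul_div_cancel₀ _ (hf 0 (Nat.zero_le _))]

/-- Arms and legs of the boxes in the row of rank `rank α 0`: the product over horizontal steps
telescopes to a product over the rows below. -/
theorem prod_row_telescope {f : ℕ → ℕ → K} (hf : ∀ e s, s ≤ n → f e s ≠ 0)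
    (α : Fin (n + 1) → ℕ) :
    (∏ j ∈ Finset.range (α 0), f (α 0 - j) (colCard α j - rank α 0)) * f 0 0 =
      (∏ j ∈ Finset.range (α 0), f (α 0 - (j + 1)) (colCard α j - rank α 0)) *
        f (α 0) (n + 1 - rank α 0) *
        ∏ k, if rank α 0 < rank α k then
          f (α 0 - α k) (rank α k - rank α 0 - 1) / f (α 0 - α k) (rank α k - rank α 0)
        else 1 := by
  set a := α 0
  set r := rank α 0
  have hr : 1 ≤ r := one_le_rank α 0
  set g : ℕ → ℕ → K := fun e s => f e (s + 1) / f e s with hg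
  have hgn : ∀ e s, s + 1 ≤ n → g e s ≠ 0 := fun e s hs =>
    div_ne_zero (hf _ _ hs) (hf _ _ (by omega))
  -- The leg `m - r` is built up one unit at a time, each unit being charged to the row whose rank
  -- lies in `(r, m]`.
  have key : ∀ e m, m ≤ n + 1 → f e (m - r) =
      f e 0 * ∏ k, if r < rank α k ∧ rank α k ≤ m then g e (rank α k - r - 1) else 1 := by
    intro e m hm
    rw [prod_rank_eq_prod_range α hm]
    exact eq_mul_prod_div fun s hs => hf e s (by omega)
  have hak : ∀ k, r < rank α k → α k ≤ a := fun k hk => by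
    have := rank_lt_iff.mp hk
    omega
  -- After exchanging the products, row `k` contributes over the columns `j < α k` only, where the
  -- arm runs from `a` down to `a - α k` and the product telescopes.
  have h1 : ∏ j ∈ Finset.range a, f (a - j) (colCard α j - r) / f (a - (j + 1)) (colCard α j - r) =
      f a 0 / f 0 0 * ∏ k, if r < rank α k then
        g a (rank α k - r - 1) / g (a - α k) (rank α k - r - 1) else 1 := by
    have e1 : ∀ j, f (a - j) (colCard α j - r) / f (a - (j + 1)) (colCard α j - r) =
        f (a - j) 0 / f (a - (j + 1)) 0 *
          ∏ k, if r < rank α k ∧ j < α k then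
            g (a - j) (rank α k - r - 1) / g (a - (j + 1)) (rank α k - r - 1) else 1 := by
      intro j
      rw [key _ _ (colCard_le α j), key (a - (j + 1)) _ (colCard_le α j), mul_div_mul_comm,
        ← Finset.prod_div_distrib]
      congr 1
      refine Finset.prod_congr rfl fun k _ => ?_
      simp only [rank_le_colCard_iff]
      split_ifs
      · rfl
      · exact div_one 1
    rw [Finset.prod_congr rfl fun j _ => e1 j, Finset.prod_mul_distrib, Finset.prod_comm]
    congr 1
    · have := prod_range_div_succ (h := fun j => f (a - j) 0) (m := a)
        fun i _ => hf _ _ (Nat.zero_le _)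
      simpa using this
    · refine Finset.prod_congr rfl fun k _ => ?_
      by_cases hk : r < rank α k
      · simp only [hk, true_and, if_true]
        have hle := hak k hk
        have hfil : (Finset.range a).filter (fun j => j < α k) = Finset.range (α k) := by
          ext j; simp; omega
        rw [← Finset.prod_filter, hfil]
        have := rank_le α k
        have := prod_range_div_succ (h := fun j => g (a - j) (rank α k - r - 1)) (m := α k)
          fun i _ => hgn _ _ (by omega)
        simpa using this
      · simp [hk]
  have h2 : f a (n + 1 - r) =
      f a 0 * ∏ k, if r < rank α k then g a (rank α k - r - 1) else 1 := by
    rw [key a (n + 1) le_rfl]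
    congr 1
    refine Finset.prod_congr rfl fun k _ => ?_
    simp only [rank_le α k, and_true]
  have hden : ∏ j ∈ Finset.range a, f (a - (j + 1)) (colCard α j - r) ≠ 0 := by
    refine Finset.prod_ne_zero_iff.mpr fun j _ => hf _ _ ?_
    have := colCard_le α j
    omega
  rw [Finset.prod_div_distrib, div_eq_iff hden] at h1
  rw [h1, h2]
  have h3 : (∏ k, if r < rank α k then
        g a (rank α k - r - 1) / g (a - α k) (rank α k - r - 1) else 1) =
      (∏ k, if r < rank α k then g a (rank α k - r - 1) else 1) *
        ∏ k, if r < rank α k then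
          f (a - α k) (rank α k - r - 1) / f (a - α k) (rank α k - r) else 1 := by
    rw [← Finset.prod_mul_distrib]
    refine Finset.prod_congr rfl fun k _ => ?_
    split_ifs with hk
    · have : rank α k - r = rank α k - r - 1 + 1 := by omega
      rw [this, Nat.add_sub_cancel, div_eq_mul_inv]
      congr 1
      rw [hg, inv_div]
    · rw [mul_one]
  rw [h3]
  have := hf 0 0 (Nat.zero_le _)
  field_simp

/-- The factor contributed by position `k` to the change of `boxProd` from `α` to `αΦ`. -/
def boxRatio (f : ℕ → ℕ → K) (α : Fin (n + 1) → ℕ) (k : Fin (n + 1)) : K :=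
  if α 0 < α k then
    f (α k - (α 0 + 1)) (rank α 0 - rank α k) / f (α k - (α 0 + 1)) (rank α 0 - 1 - rank α k)
  else f (α 0 - α k) (rank α k - rank α 0 - 1) / f (α 0 - α k) (rank α k - rank α 0)

/-- `Φ` adds one box to the first row, at column `α 0`. In each longer row the box of that column
gains one unit of leg; in the extended row every old arm grows by one and the new box has arm and
leg zero, a change evaluated by `prod_row_telescope`. -/
theorem boxProd_affineLabel {f : ℕ → ℕ → K} (hf : ∀ e s, s ≤ n → f e s ≠ 0)
    (α : Fin (n + 1) → ℕ) :
    boxProd f (affineLabel α) = boxProd f α *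
      (f (α 0) (n + 1 - rank α 0) * ∏ k : Fin n, boxRatio f α k.succ) := by
  have hc0 : colCard α (α 0) = rank α 0 - 1 := by rw [rank_zero_eq]; rfl
  have hr := one_le_rank α 0
  have hrow : ∀ k : Fin n,
      ∏ j ∈ Finset.range (α k.succ),
          f (α k.succ - (j + 1)) (colCard (affineLabel α) j - rank α k.succ) =
        (∏ j ∈ Finset.range (α k.succ), f (α k.succ - (j + 1)) (colCard α j - rank α k.succ)) *
          if α 0 < α k.succ then
            f (α k.succ - (α 0 + 1)) (rank α 0 - rank α k.succ) /
              f (α k.succ - (α 0 + 1)) (rank α 0 - 1 - rank α k.succ)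
          else 1 := by
    intro k
    split_ifs with hk
    · have hmem : α 0 ∈ Finset.range (α k.succ) := Finset.mem_range.mpr hk
      rw [← Finset.mul_prod_erase _ _ hmem, ← Finset.mul_prod_erase _ _ hmem,
        colCard_affineLabel, if_pos rfl, hc0, Nat.sub_add_cancel hr]
      have hE : ∏ j ∈ (Finset.range (α k.succ)).erase (α 0),
            f (α k.succ - (j + 1)) (colCard (affineLabel α) j - rank α k.succ) =
          ∏ j ∈ (Finset.range (α k.succ)).erase (α 0),
            f (α k.succ - (j + 1)) (colCard α j - rank α k.succ) := by
        refine Finset.prod_congr rfl fun j hj => ?_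
        rw [colCard_affineLabel, if_neg (Finset.ne_of_mem_erase hj), add_zero]
      have := rank_le α 0
      have := one_le_rank α k.succ
      have hne : f (α k.succ - (α 0 + 1)) (rank α 0 - 1 - rank α k.succ) ≠ 0 := hf _ _ (by omega)
      rw [hE, mul_right_comm, mul_div_cancel₀ _ hne]
    · rw [mul_one]
      refine Finset.prod_congr rfl fun j hj => ?_
      rw [colCard_affineLabel, if_neg, add_zero]
      rw [Finset.mem_range] at hj
      omega
  have hrow0 : ∏ j ∈ Finset.range (α 0 + 1),
        f (α 0 + 1 - (j + 1)) (colCard (affineLabel α) j - rank α 0) =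
      (∏ j ∈ Finset.range (α 0), f (α 0 - j) (colCard α j - rank α 0)) * f 0 0 := by
    rw [Finset.prod_range_succ, colCard_affineLabel, if_pos rfl, hc0, Nat.sub_add_cancel hr,
      Nat.sub_self, Nat.sub_self]
    congr 1
    refine Finset.prod_congr rfl fun j hj => ?_
    rw [Finset.mem_range] at hj
    rw [colCard_affineLabel, if_neg hj.ne, add_zero, Nat.add_sub_add_right]
  have hsplit : ∏ k : Fin n, boxRatio f α k.succ =
      (∏ k : Fin n, if α 0 < α k.succ then
            f (α k.succ - (α 0 + 1)) (rank α 0 - rank α k.succ) /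
              f (α k.succ - (α 0 + 1)) (rank α 0 - 1 - rank α k.succ)
          else 1) *
        ∏ k : Fin (n + 1), if rank α 0 < rank α k then
          f (α 0 - α k) (rank α k - rank α 0 - 1) / f (α 0 - α k) (rank α k - rank α 0)
        else 1 := by
    rw [Fin.prod_univ_succ (fun k : Fin (n + 1) => if rank α 0 < rank α k then _ else _),
      if_neg (lt_irrefl _), one_mul, ← Finset.prod_mul_distrib]
    refine Finset.prod_congr rfl fun k _ => ?_
    have h0 : (0 : Fin (n + 1)) < k.succ := Fin.succ_pos k
    have hiff := rank_lt_iff (α := α) (i := 0) (j := k.succ)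
    rw [boxRatio]
    by_cases hk : α 0 < α k.succ
    · rw [if_pos hk, if_pos hk, if_neg (by rw [hiff]; omega), mul_one]
    · rw [if_neg hk, if_neg hk, if_pos (by rw [hiff]; omega), one_mul]
  rw [boxProd, boxProd, Fin.prod_univ_castSucc, Fin.prod_univ_succ, hsplit]
  simp only [affineLabel_castSucc, affineLabel_last, rank_affineLabel_castSucc,
    rank_affineLabel_last]
  rw [Finset.prod_congr rfl fun k _ => hrow k, hrow0, prod_row_telescope hf,
    Finset.prod_mul_distrib]
  ring

/-- The product of the step factors over the inversions of `α`, the pairs `i < j` with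
`α_i < α_j`. -/
noncomputable def inversionProd (q t : K) (α : Fin (n + 1) → ℕ) : K :=
  ∏ p : Fin (n + 1) × Fin (n + 1), if p.1 < p.2 ∧ α p.1 < α p.2 then
    stepFactor t (zeta q t α p.2 / zeta q t α p.1) else 1

theorem inversionProd_of_antitone (q t : K) {lam : Fin (n + 1) → ℕ} (h : Antitone lam) :
    inversionProd q t lam = 1 := by
  refine Finset.prod_eq_one fun p _ => if_neg fun hp => ?_
  exact absurd (h hp.1.le) (not_le.mpr hp.2)

theorem val_adj (i : Fin n) (x : Fin (n + 1)) :
    (adj i x : ℕ) = if (x : ℕ) = i then (i : ℕ) + 1 else if (x : ℕ) = i + 1 then (i : ℕ) else x := by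
  split_ifs with h1 h2
  · obtain rfl : x = i.castSucc := Fin.ext h1
    rw [adj_castSucc, Fin.val_succ]
  · obtain rfl : x = i.succ := Fin.ext h2
    rw [adj_succ, Fin.val_castSucc]
  · rw [adj_of_ne (fun h => h1 (by rw [h, Fin.val_castSucc]))
      (fun h => h2 (by rw [h, Fin.val_succ]))]

theorem adj_lt_adj {i : Fin n} {x y : Fin (n + 1)} (h1 : ¬(x = i.castSucc ∧ y = i.succ))
    (h2 : ¬(x = i.succ ∧ y = i.castSucc)) : adj i x < adj i y ↔ x < y := by
  simp only [Fin.ext_iff, Fin.lt_def, Fin.val_castSucc, Fin.val_succ, val_adj] at *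
  split_ifs <;> omega

/-- `s_i` transports pairs of positions together with their spectral values and keeps the order
within every pair except `{i, i + 1}`, so exactly this inversion disappears. -/
theorem inversionProd_eq_mul (q t : K) {α : Fin (n + 1) → ℕ} {i : Fin n}
    (hi : α i.castSucc < α i.succ) :
    inversionProd q t α = stepFactor t (zeta q t α i.succ / zeta q t α i.castSucc) *
      inversionProd q t (α ∘ adj i) := by
  have hE : inversionProd q t (α ∘ adj i) =
      ∏ p : Fin (n + 1) × Fin (n + 1), if adj i p.1 < adj i p.2 ∧ α p.1 < α p.2 then
        stepFactor t (zeta q t α p.2 / zeta q t α p.1) else 1 := by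
    rw [inversionProd, ← Equiv.prod_comp ((adj i).prodCongr (adj i))]
    simp only [Equiv.prodCongr_apply, Prod.map_fst, Prod.map_snd, zeta_comp_adj hi.ne,
      Function.comp_apply, adj_adj]
  have hmem : (i.castSucc, i.succ) ∈ (Finset.univ : Finset (Fin (n + 1) × Fin (n + 1))) :=
    Finset.mem_univ _
  rw [hE, inversionProd, ← Finset.mul_prod_erase _ _ hmem, ← Finset.mul_prod_erase _ _ hmem]
  simp only [adj_castSucc, adj_succ, Fin.castSucc_lt_succ, hi, and_self, if_true,
    Fin.castSucc_lt_succ.not_gt, false_and, if_false, one_mul]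
  congr 1
  refine Finset.prod_congr rfl fun p hp => ?_
  have hp1 : ¬(p.1 = i.castSucc ∧ p.2 = i.succ) := fun h =>
    Finset.ne_of_mem_erase hp (Prod.ext h.1 h.2)
  by_cases hp2 : p.1 = i.succ ∧ p.2 = i.castSucc
  · rw [hp2.1, hp2.2, if_neg fun h => absurd h.2 hi.not_gt, if_neg fun h => absurd h.2 hi.not_gt]
  · simp only [adj_lt_adj hp1 hp2]

/-- Moving the first entry to the end destroys its inversions with larger entries and creates
inversions with the entries below `α 0 + 1`; all others persist. The relation is cross-multiplied to
avoid division. -/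
theorem inversionProd_affine (q t : K) (α : Fin (n + 1) → ℕ) :
    inversionProd q t (affineLabel α) *
        (∏ k : Fin n, if α 0 < α k.succ then
          stepFactor t (zeta q t α k.succ / zeta q t α 0) else 1) =
      inversionProd q t α *
        ∏ k : Fin n, if α 0 < α k.succ then 1 else
          stepFactor t (q * zeta q t α 0 / zeta q t α k.succ) := by
  have hcs : ∀ F : Fin (n + 1) → Fin (n + 1) → K, ∏ x, ∏ y, F x y =
      (∏ x : Fin n, ∏ y : Fin n, F x.castSucc y.castSucc) * (∏ x : Fin n, F x.castSucc (Fin.last n)) *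
        ∏ y, F (Fin.last n) y := by
    intro F
    rw [Fin.prod_univ_castSucc, ← Finset.prod_mul_distrib]
    simp only [fun x : Fin n => Fin.prod_univ_castSucc (F x.castSucc)]
  have hsu : ∀ F : Fin (n + 1) → Fin (n + 1) → K, ∏ x, ∏ y, F x y =
      (∏ x : Fin n, ∏ y : Fin n, F x.succ y.succ) * (∏ x : Fin n, F x.succ 0) *
        (F 0 0 * ∏ y : Fin n, F 0 y.succ) := by
    intro F
    rw [Fin.prod_univ_succ, ← Finset.prod_mul_distrib, Fin.prod_univ_succ (F 0), mul_comm]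
    congr 1
    refine Finset.prod_congr rfl fun x _ => ?_
    rw [Fin.prod_univ_succ, mul_comm]
  rw [inversionProd, inversionProd, Fintype.prod_prod_type, Fintype.prod_prod_type,
    hcs (fun x y => ite _ _ _), hsu (fun x y => ite _ _ _)]
  have hlast : ∀ y : Fin (n + 1), ¬ Fin.last n < y := fun y => not_lt.mpr (Fin.le_last y)
  simp only [affineLabel_castSucc, affineLabel_last, zeta_affineLabel_castSucc,
    zeta_affineLabel_last, Fin.castSucc_lt_castSucc_iff, Fin.succ_lt_succ_iff, Fin.castSucc_lt_last,
    Fin.succ_pos, Fin.not_lt_zero, hlast, true_and, false_and, if_false, Finset.prod_const_one,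
    mul_one, one_mul]
  have hif : ∀ x : Fin n, (if α x.succ < α 0 + 1 then
      stepFactor t (q * zeta q t α 0 / zeta q t α x.succ) else 1) =
      if α 0 < α x.succ then 1 else stepFactor t (q * zeta q t α 0 / zeta q t α x.succ) := by
    intro x
    split_ifs <;> first | rfl | omega
  rw [Finset.prod_congr rfl fun x _ => hif x]
  ring

end Combinatorics

/-! ### The closed formula and its agreement with the norm recursions. -/

section Norm

variable {K : Type*} [Field K] {n : ℕ} {q t : K}

/-- `1 - z q^a t^l`, the factor of a box with arm `a` and leg `l` in a hook product. -/
def boxFactor (q t z : K) (a l : ℕ) : K := 1 - z * q ^ a * t ^ l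

/-- The norm formula, extended from partitions to compositions by replacing the row index with the
rank; it depends only on the decreasing rearrangement. -/
noncomputable def normValue (q t : K) (α : Fin (n + 1) → ℕ) : K :=
  t ^ (∑ i, (((n + 1 : ℕ) : ℤ) + 1 - 2 * (rank α i : ℤ)) * (α i : ℤ)) *
    (boxProd (boxFactor q t q) α / boxProd (boxFactor q t (q * t)) α) *
    ((∏ i, qPoch (q * t ^ (n + 1) * t ^ (1 - (rank α i : ℤ))) q (α i)) / (1 - q) ^ (∑ i, α i))

theorem boxProd_boxFactor_of_antitone {lam : Fin (n + 1) → ℕ} (h : Antitone lam) (z : K) :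
    boxProd (boxFactor q t z) lam = hook q t lam z := by
  simp only [boxProd, hook, boxFactor, colCard, rank_of_antitone h]

theorem normValue_of_antitone {lam : Fin (n + 1) → ℕ} (h : Antitone lam) :
    normValue q t lam = t ^ kExp lam * (hook q t lam q / hook q t lam (q * t)) *
      (qtPoch (q * t ^ (n + 1)) q t lam / (1 - q) ^ (∑ i, lam i)) := by
  rw [normValue, boxProd_boxFactor_of_antitone h, boxProd_boxFactor_of_antitone h, kExp, qtPoch]
  have e1 : ∀ i : Fin (n + 1), ((n + 1 : ℕ) : ℤ) + 1 - 2 * (rank lam i : ℤ) =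
      ((n + 1 : ℕ) : ℤ) - 2 * (((i : ℕ) : ℤ) + 1) + 1 := by
    intro i
    rw [rank_of_antitone h]
    push_cast
    ring
  have e2 : ∀ i : Fin (n + 1), 1 - (rank lam i : ℤ) = -((i : ℕ) : ℤ) := by
    intro i
    rw [rank_of_antitone h]
    push_cast
    ring
  simp only [e1, e2]

theorem normValue_comp_adj {α : Fin (n + 1) → ℕ} {i : Fin n} (h : α i.castSucc ≠ α i.succ) :
    normValue q t (α ∘ adj i) = normValue q t α := by
  rw [normValue, normValue, boxProd_comp_adj _ h, boxProd_comp_adj _ h]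
  simp only [rank_comp_adj h, Function.comp_apply]
  rw [Equiv.sum_comp (adj i) α,
    Equiv.sum_comp (adj i) fun k => (((n + 1 : ℕ) : ℤ) + 1 - 2 * (rank α k : ℤ)) * (α k : ℤ),
    Equiv.prod_comp (adj i) fun k => qPoch (q * t ^ (n + 1) * t ^ (1 - (rank α k : ℤ))) q (α k)]

theorem IsGeneric.boxFactor_ne_zero (h : IsGeneric (n + 1) q t) (e s : ℕ) (hs : s ≤ n + 1) :
    boxFactor q t q e s ≠ 0 := by
  have := h.ne_one (a := (e : ℤ) + 1) (b := s) (by omega) (by rw [abs_le]; omega)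
  rw [zpow_add_one₀ h.1, zpow_natCast, zpow_natCast] at this
  rw [boxFactor, sub_ne_zero, mul_comm q]
  exact this.symm

/-- Replacing `q` by `q t` lengthens the leg by one, so leg `n` uses genericity at the extreme
exponent `b = N`. -/
theorem IsGeneric.boxFactor_mul_ne_zero (h : IsGeneric (n + 1) q t) (e s : ℕ) (hs : s ≤ n) :
    boxFactor q t (q * t) e s ≠ 0 := by
  have := h.boxFactor_ne_zero e (s + 1) (by omega)
  rwa [boxFactor, pow_succ', show q * q ^ e * (t * t ^ s) = q * t * q ^ e * t ^ s by ring] at this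

theorem IsGeneric.stepFactor_ne_zero (h : IsGeneric (n + 1) q t) {a b : ℤ} (ha : a ≠ 0)
    (hb : |b| ≤ n) : stepFactor t (q ^ a * t ^ b) ≠ 0 := by
  rw [abs_le] at hb
  have h1 := h.ne_one (b := b) ha (by rw [abs_le]; push_cast; omega)
  have h2 := h.ne_one (b := b + 1) ha (by rw [abs_le]; push_cast; omega)
  have h3 := h.ne_one (b := b - 1) ha (by rw [abs_le]; push_cast; omega)
  have e2 : 1 - t * (q ^ a * t ^ b) = 1 - q ^ a * t ^ (b + 1) := by
    rw [zpow_add_one₀ h.2.1]; ring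
  have e3 : t - q ^ a * t ^ b = t * (1 - q ^ a * t ^ (b - 1)) := by
    have := h.2.1
    rw [zpow_sub_one₀ h.2.1]; field_simp
  rw [stepFactor, e2, e3]
  exact div_ne_zero (mul_ne_zero (mul_ne_zero h.2.1 (sub_ne_zero.mpr h3.symm))
    (sub_ne_zero.mpr h2.symm)) (pow_ne_zero _ (sub_ne_zero.mpr h1.symm))

theorem IsGeneric.inversionProd_ne_zero (h : IsGeneric (n + 1) q t) (α : Fin (n + 1) → ℕ) :
    inversionProd q t α ≠ 0 := by
  refine Finset.prod_ne_zero_iff.mpr fun p _ => ?_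
  split_ifs with hp
  · rw [zeta_div h.1 h.2.1]
    refine h.stepFactor_ne_zero (by omega) ?_
    have := one_le_rank α p.1
    have := one_le_rank α p.2
    have := rank_le α p.1
    have := rank_le α p.2
    rw [abs_le]
    omega
  · exact one_ne_zero

/-- The contribution of position `k` to the ratio of hook products, in terms of step factors. -/
theorem boxRatio_div (h : IsGeneric (n + 1) q t) (α : Fin (n + 1) → ℕ) (k : Fin n) :
    boxRatio (boxFactor q t q) α k.succ / boxRatio (boxFactor q t (q * t)) α k.succ *
        (if α 0 < α k.succ then stepFactor t (zeta q t α k.succ / zeta q t α 0) else 1) =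
      (if α 0 < α k.succ then 1 else stepFactor t (q * zeta q t α 0 / zeta q t α k.succ)) *
        if α 0 < α k.succ then t else t⁻¹ := by
  have hq := h.1
  have ht := h.2.1
  have h0 := one_le_rank α 0
  have hk := one_le_rank α k.succ
  have h0' := rank_le α 0
  have hk' := rank_le α k.succ
  have hiff := rank_lt_iff (α := α) (i := 0) (j := k.succ)
  have hiff' := rank_lt_iff (α := α) (i := k.succ) (j := 0)
  have hpos : (0 : Fin (n + 1)) < k.succ := Fin.succ_pos k
  -- Let `F s` be the box factor with `z = q` and the arm `e` found below. The quotient of box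
  -- ratios is `F (s+1)² / (F s * F (s+2))` or its inverse, while the step factor at `q^(e+1)
  -- t^(s+1)` is `t * F s * F (s+2) / F (s+1)²`.
  have hs : ∀ e s, boxFactor q t q e (s + 1) = boxFactor q t (q * t) e s := by
    intro e s
    rw [boxFactor, boxFactor, pow_succ]
    ring
  rw [boxRatio, boxRatio]
  split_ifs with hlt
  · obtain ⟨e, he⟩ : ∃ e, α k.succ = α 0 + 1 + e := ⟨_, (Nat.add_sub_cancel' hlt).symm⟩
    have hr : rank α k.succ < rank α 0 := by rw [hiff']; omega
    obtain ⟨s, hs'⟩ : ∃ s, rank α 0 = rank α k.succ + 1 + s := ⟨_, (Nat.add_sub_cancel' hr).symm⟩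
    have es : rank α 0 - rank α k.succ = s + 1 := by omega
    have es' : rank α 0 - 1 - rank α k.succ = s := by omega
    have ee : α k.succ - (α 0 + 1) = e := by omega
    have hy : zeta q t α k.succ / zeta q t α 0 = q ^ (e + 1) * t ^ (s + 1) := by
      rw [zeta_div hq ht, ← zpow_natCast q, ← zpow_natCast t]
      congr 2 <;> push_cast <;> omega
    rw [es, es', ee, hy]
    have n1 := h.boxFactor_ne_zero e s (by omega)
    have n2 := h.boxFactor_ne_zero e (s + 1) (by omega)
    have n3 := h.boxFactor_ne_zero e (s + 2) (by omega)
    rw [hs e (s + 1)] at n3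
    rw [hs] at n2 ⊢
    have b1 : 1 - q ^ (e + 1) * t ^ (s + 1) = boxFactor q t (q * t) e s := by
      rw [boxFactor]; ring
    have b2 : 1 - t * (q ^ (e + 1) * t ^ (s + 1)) = boxFactor q t (q * t) e (s + 1) := by
      rw [boxFactor]; ring
    have b3 : t - q ^ (e + 1) * t ^ (s + 1) = t * boxFactor q t q e s := by
      rw [boxFactor]; ring
    rw [stepFactor, b1, b2, b3]
    field_simp
  · obtain ⟨e, he⟩ : ∃ e, α 0 = α k.succ + e := ⟨_, (Nat.add_sub_cancel' (not_lt.mp hlt)).symm⟩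
    have hr : rank α 0 < rank α k.succ := by rw [hiff]; omega
    obtain ⟨s, hs'⟩ : ∃ s, rank α k.succ = rank α 0 + 1 + s := ⟨_, (Nat.add_sub_cancel' hr).symm⟩
    have es : rank α k.succ - rank α 0 = s + 1 := by omega
    have es' : rank α k.succ - rank α 0 - 1 = s := by omega
    have ee : α 0 - α k.succ = e := by omega
    have hy : q * zeta q t α 0 / zeta q t α k.succ = q ^ (e + 1) * t ^ (s + 1) := by
      rw [mul_div_assoc, zeta_div hq ht, pow_succ', mul_assoc, ← zpow_natCast q, ← zpow_natCast t]
      congr 3 <;> push_cast <;> omega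
    rw [es', es, ee, hy]
    have n1 := h.boxFactor_ne_zero e s (by omega)
    have n2 := h.boxFactor_ne_zero e (s + 1) (by omega)
    have n3 := h.boxFactor_ne_zero e (s + 2) (by omega)
    rw [hs e (s + 1)] at n3
    rw [hs] at n2 ⊢
    have b1 : 1 - q ^ (e + 1) * t ^ (s + 1) = boxFactor q t (q * t) e s := by
      rw [boxFactor]; ring
    have b2 : 1 - t * (q ^ (e + 1) * t ^ (s + 1)) = boxFactor q t (q * t) e (s + 1) := by
      rw [boxFactor]; ring
    have b3 : t - q ^ (e + 1) * t ^ (s + 1) = t * boxFactor q t q e s := by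
      rw [boxFactor]; ring
    rw [stepFactor, b1, b2, b3]
    field_simp

/-- Exactly `rank α 0 - 1` entries exceed `α 0`. The resulting power of `t` cancels the change of
the exponent in `normValue` under `Φ`. -/
theorem prod_ite_inv (ht : t ≠ 0) (α : Fin (n + 1) → ℕ) :
    ∏ k : Fin n, (if α 0 < α k.succ then t else t⁻¹) = t ^ (2 * (rank α 0 : ℤ) - 2 - n) := by
  have hc : rank α 0 = (∑ k : Fin n, if α 0 < α k.succ then 1 else 0) + 1 := by
    rw [rank_zero_eq, colCard_eq_sum, Fin.sum_univ_succ, if_neg (by omega), zero_add]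
    simp only [Nat.succ_le_iff]
  have hp : ∀ s : Finset (Fin n), ∏ k ∈ s, (if α 0 < α k.succ then t else t⁻¹) =
      t ^ (2 * ((∑ k ∈ s, if α 0 < α k.succ then 1 else 0 : ℕ) : ℤ) - s.card) := by
    intro s
    induction s using Finset.induction_on with
    | empty => simp
    | insert k s hk ih =>
      rw [Finset.prod_insert hk, Finset.sum_insert hk, Finset.card_insert_of_notMem hk, ih]
      split_ifs
      · rw [← zpow_one_add₀ ht]
        congr 1
        push_cast
        ring
      · rw [← zpow_neg_one, ← zpow_add₀ ht]
        congr 1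
        push_cast
        ring
  rw [hp, hc, Finset.card_univ, Fintype.card_fin]
  congr 1
  push_cast
  ring

theorem qPoch_succ (z q : K) (m : ℕ) : qPoch z q (m + 1) = qPoch z q m * (1 - z * q ^ m) :=
  Finset.prod_range_succ _ _

/-- The new Pochhammer factor cancels the new factor of the `q t` hook product, and the new factor
of the `q` hook product is `1 - q ζ_α(1)`. The remaining box ratios match the change of
`inversionProd` up to powers of `t`, which cancel. -/
theorem normValue_affine (h : IsGeneric (n + 1) q t) (α : Fin (n + 1) → ℕ) :
    (1 - q) * (normValue q t (affineLabel α) * inversionProd q t α) =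
      inversionProd q t (affineLabel α) * ((1 - q * zeta q t α 0) * normValue q t α) := by
  have hq := h.1
  have ht := h.2.1
  have h0 := one_le_rank α 0
  have h0' := rank_le α 0
  have hq1 : 1 - q ≠ 0 := sub_ne_zero.mpr h.q_ne_one.symm
  have hf1 : ∀ e s, s ≤ n → boxFactor q t q e s ≠ 0 := fun e s hs =>
    h.boxFactor_ne_zero e s (by omega)
  have hf2 := h.boxFactor_mul_ne_zero
  have hk : (∑ i, (((n + 1 : ℕ) : ℤ) + 1 - 2 * (rank (affineLabel α) i : ℤ)) *
        (affineLabel α i : ℤ)) =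
      (∑ i, (((n + 1 : ℕ) : ℤ) + 1 - 2 * (rank α i : ℤ)) * (α i : ℤ)) +
        ((n : ℤ) + 2 - 2 * rank α 0) := by
    rw [Fin.sum_univ_castSucc, Fin.sum_univ_succ]
    simp only [affineLabel_castSucc, affineLabel_last, rank_affineLabel_castSucc,
      rank_affineLabel_last]
    push_cast
    ring
  have hsum : ∑ i, affineLabel α i = (∑ i, α i) + 1 := by
    rw [Fin.sum_univ_castSucc, Fin.sum_univ_succ]
    simp only [affineLabel_castSucc, affineLabel_last]
    ring
  have hpoch : ∏ i, qPoch (q * t ^ (n + 1) * t ^ (1 - (rank (affineLabel α) i : ℤ))) q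
        (affineLabel α i) =
      (∏ i, qPoch (q * t ^ (n + 1) * t ^ (1 - (rank α i : ℤ))) q (α i)) *
        boxFactor q t (q * t) (α 0) (n + 1 - rank α 0) := by
    rw [Fin.prod_univ_castSucc, Fin.prod_univ_succ]
    simp only [affineLabel_castSucc, affineLabel_last, rank_affineLabel_castSucc,
      rank_affineLabel_last]
    have : q * t ^ (n + 1) * t ^ (1 - (rank α 0 : ℤ)) * q ^ α 0 =
        q * t * q ^ α 0 * t ^ (n + 1 - rank α 0) := by
      rw [← zpow_natCast t (n + 1), ← zpow_natCast t (n + 1 - rank α 0), mul_assoc q,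
        ← zpow_add₀ ht, mul_assoc q t, mul_comm t, ← mul_assoc q, mul_assoc _ t, ← zpow_one_add₀ ht,
        mul_right_comm]
      congr 2
      omega
    rw [qPoch_succ, this, boxFactor]
    ring
  have hz : 1 - q * zeta q t α 0 = boxFactor q t q (α 0) (n + 1 - rank α 0) := by
    rw [zeta, boxFactor, ← zpow_natCast t, Nat.cast_sub h0', mul_assoc]
  have hprod := Finset.prod_congr (s₁ := (Finset.univ : Finset (Fin n))) rfl
    fun k _ => boxRatio_div h α k
  rw [Finset.prod_mul_distrib, Finset.prod_mul_distrib, Finset.prod_div_distrib,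
    prod_ite_inv ht] at hprod
  have hinv := inversionProd_affine q t α
  have hne : ∀ {f : ℕ → ℕ → K}, (∀ e s, s ≤ n → f e s ≠ 0) →
      (∏ k : Fin n, boxRatio f α k.succ) ≠ 0 ∧ boxProd f α ≠ 0 := by
    intro f hf
    constructor
    · refine Finset.prod_ne_zero_iff.mpr fun k _ => ?_
      have := one_le_rank α k.succ
      have := rank_le α k.succ
      rw [boxRatio]
      split_ifs
      · exact div_ne_zero (hf _ _ (by omega)) (hf _ _ (by omega))
      · exact div_ne_zero (hf _ _ (by omega)) (hf _ _ (by omega))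
    · refine Finset.prod_ne_zero_iff.mpr fun i _ => Finset.prod_ne_zero_iff.mpr fun j _ => ?_
      have := one_le_rank α i
      have := colCard_le α j
      exact hf _ _ (by omega)
  have hS : (∏ k : Fin n, if α 0 < α k.succ then
      stepFactor t (zeta q t α k.succ / zeta q t α 0) else 1) ≠ 0 := by
    refine Finset.prod_ne_zero_iff.mpr fun k _ => ?_
    split_ifs with hp
    · rw [zeta_div hq ht]
      refine h.stepFactor_ne_zero (by omega) ?_
      have := one_le_rank α k.succ
      have := rank_le α k.succ
      rw [abs_le]
      omega
    · exact one_ne_zero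
  have hexp : t ^ ((n : ℤ) + 2 - 2 * rank α 0) * t ^ (2 * (rank α 0 : ℤ) - 2 - n) = 1 := by
    rw [← zpow_add₀ ht, show (n : ℤ) + 2 - 2 * rank α 0 + (2 * rank α 0 - 2 - n) = 0 by ring,
      zpow_zero]
  obtain ⟨r2, p2⟩ := hne hf2
  have hfa := hf2 (α 0) (n + 1 - rank α 0) (by omega)
  rw [normValue, normValue, hk, hsum, hpoch, hz, boxProd_affineLabel hf1, boxProd_affineLabel hf2,
    zpow_add₀ ht, pow_succ (1 - q)]
  generalize t ^ (∑ i, (((n + 1 : ℕ) : ℤ) + 1 - 2 * (rank α i : ℤ)) * (α i : ℤ)) = x0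
  generalize (∏ k : Fin n, boxRatio (boxFactor q t q) α k.succ) = R1 at *
  generalize (∏ k : Fin n, boxRatio (boxFactor q t (q * t)) α k.succ) = R2 at *
  generalize boxProd (boxFactor q t q) α = P1 at *
  generalize boxProd (boxFactor q t (q * t)) α = P2 at *
  generalize boxFactor q t q (α 0) (n + 1 - rank α 0) = F1 at *
  generalize boxFactor q t (q * t) (α 0) (n + 1 - rank α 0) = F2 at *
  generalize t ^ ((n : ℤ) + 2 - 2 * rank α 0) = u at *
  generalize t ^ (2 * (rank α 0 : ℤ) - 2 - n) = v at *
  generalize (∏ k : Fin n, if α 0 < α k.succ then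
      stepFactor t (zeta q t α k.succ / zeta q t α 0) else 1) = S at *
  generalize (∏ k : Fin n, if α 0 < α k.succ then 1 else
      stepFactor t (q * zeta q t α 0 / zeta q t α k.succ)) = S' at *
  generalize inversionProd q t α = I at *
  generalize inversionProd q t (affineLabel α) = I' at *
  have hR : R1 * S = S' * v * R2 := by
    rw [← hprod]
    field_simp
  -- The identity left after those cancellations; multiplying by `S` allows the cross-multiplied
  -- inversion relation to be used.
  have key : u * R1 * I = I' * R2 := by
    apply mul_right_cancel₀ hS
    linear_combination u * I * hR + u * v * R2 * (-hinv) + I' * S * R2 * hexp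
  have hD : (1 - q) ^ (∑ i, α i) ≠ 0 := pow_ne_zero _ hq1
  generalize (1 - q) ^ (∑ i, α i) = D at *
  field_simp
  linear_combination
    x0 * P1 * F1 * (∏ i, qPoch (q * t ^ (n + 1) * t ^ (1 - (rank α i : ℤ))) q (α i)) * key

/-- The squared norm of a nonsymmetric Macdonald polynomial with arbitrary label. -/
theorem BF1.inversionProd_mul_norm {B : LinearMap.BilinForm K (MvPolynomial (Fin (n + 1)) K)}
    (hqt : IsGeneric (n + 1) q t) (hB : BF1 q t B) {α : Fin (n + 1) → ℕ}
    {p : MvPolynomial (Fin (n + 1)) K} (hp : IsMacdonald q t α p) :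
    inversionProd q t α * B p p = normValue q t α := by
  induction hp with
  | root =>
    have h0 : Antitone (0 : Fin (n + 1) → ℕ) := fun _ _ _ => le_rfl
    rw [inversionProd_of_antitone q t h0, hB.one_one, normValue_of_antitone h0]
    simp [kExp, hook, qtPoch, qPoch]
  | @step α p i hi hp ih =>
    rw [hB.step_norm hqt hp hi, normValue_comp_adj hi.ne, ← ih, inversionProd_eq_mul q t hi]
    ring
  | @affine α p hp ih =>
    have hq1 : 1 - q ≠ 0 := sub_ne_zero.mpr hqt.q_ne_one.symm
    have h1 := hB.affine_norm hqt hp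
    have h2 := normValue_affine hqt α
    change inversionProd q t (affineLabel α) * _ = normValue q t (affineLabel α)
    apply mul_left_cancel₀ hq1
    apply mul_right_cancel₀ (hqt.inversionProd_ne_zero α)
    rw [← ih] at h2
    linear_combination inversionProd q t (affineLabel α) * inversionProd q t α * h1 - h2

end Norm

end Macdonald

theorem mainTheorem5 {K : Type*} [Field K] (n : ℕ) (q t : K)
    (hqt : Macdonald.IsGeneric (n + 1) q t)
    (B : LinearMap.BilinForm K (MvPolynomial (Fin (n + 1)) K))
    (hB : Macdonald.BF1 q t B)
    (lam : Fin (n + 1) → ℕ) (hlam : Antitone lam)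
    (M : MvPolynomial (Fin (n + 1)) K) (hM : Macdonald.IsMacdonald q t lam M) :
    B M M =
      t ^ Macdonald.kExp lam *
        (Macdonald.hook q t lam q / Macdonald.hook q t lam (q * t)) *
        (Macdonald.qtPoch (q * t ^ (n + 1)) q t lam / (1 - q) ^ (∑ i, lam i)) := by
  rw [← Macdonald.normValue_of_antitone hlam, ← hB.inversionProd_mul_norm hqt hM,
    Macdonald.inversionProd_of_antitone q t hlam, one_mul]
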